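/- Let $d\ge 1$, $K,\sigma,h>0$ with $N:=2K/h\in\mathbb N$, $N\ge 2$, let $D=[-K,K]^d$, and let $\mathcal K_h$ be the set of points $i=(i_1,\dots,i_d)$ with $i_j=-K+hn_j-h/2$, $n_j\in\{1,\dots,N\}$. Let $e_1,\dots,e_d$ be the standard basis of $\mathbb R^d$ and let $G=\{\pm_j: j=1,\dots,d\}$ be the set of moves $\pm_j: i\mapsto \pm_j i:= i\pm he_j$. For $V\in C^2(\mathbb R^d)$ set $$V^h(i)=h^{-d}\int_{[-h/2,h/2]^d}V(i+s)\,ds,$$ $$c(i,\gamma)=\frac{\sigma^2}{h^2}e^{-(V^h(\gamma i)-V^h(i))/(2\sigma^2)}\ \text{ if }\gamma i\in\mathcal K_h,\qquad c(i,\gamma)=0\ \text{ otherwise},$$ $$\mathcal T=2\max_{i\in\mathcal K_h}\sum_{\gamma\in G}c(i,\gamma),\qquad \tau=1/\mathcal T,\qquad m_h(i)=\frac{e^{-V^h(i)/\sigma^2}}{\sum_{k\in\mathcal K_h}e^{-V^h(k)/\sigma^2}}.$$ Let $\pi$ be the transition matrix on $\mathcal K_h$ with $\pi(i,\gamma i)=c(i,\gamma)/\mathcal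 T$ for $\gamma\in G$ with $\gamma i\in\mathcal K_h$, $\pi(i,i)=1-\sum_{\gamma\in G}c(i,\gamma)/\mathcal T$, and all other entries $0$, and let $\pi f(i)=\sum_{k}\pi(i,k)f(k)$. For $i,\,i\pm he_j\in\mathcal K_h$ put $$\kappa_\pm(i,j)=c(i,\pm_j)-c(i\pm he_j,\pm_j)-\sum_{\gamma\in G\setminus\{+_j,-_j\}}\max\{c(i\pm he_j,\gamma)-c(i,\gamma),0\},$$ and let $$\kappa_1=\min\{\kappa_+(i,j)+\kappa_-(i+he_j,j): 1\le j\le d,\ i,\,i+he_j\in\mathcal K_h\}.$$ Finally, for $f:\mathcal K_h\to[0,\infty)$ and $\phi_1(x)=x\log x-x+1$ (with $0\log 0=0$), let $$\mathcal H^{\phi_1}(f|m_h)=\sum_{i\in\mathcal K_h}\phi_1(f(i))m_h(i)-\phi_1\Big(\sum_{i\in\mathcal K_h}f(i)m_h(i)\Big).$$ **Corollary.** Assume that $V\in C^2(\mathbb R^d)$ is additive, i.e. there are functions $V_1,\dots,V_d:\mathbb R\to\mathbb R$ with $V(i)=\sum_{j=1}^dV_j(i_j)$ for all $i\in\mathcal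 K_h$, that $\nabla V$ is Lipschitz continuous on $D$, and that * (A2) there is $\kappa>0$ with $\langle x-y,\nabla V(x)-\nabla V(y)\rangle\ge\kappa|x-y|^2$ for all $x,y\in D$; * (A3) $\kappa_+(i,j)>0$ whenever $i,\,i+he_j\in\mathcal K_h$, and $\kappa_-(i,j)>0$ whenever $i,\,i-he_j\in\mathcal K_h$. Then, for all $f:\mathcal K_h\to[0,\infty)$ and all $n\in\mathbb N$ (including $n=0$), $$\mathcal H^{\phi_1}(\pi^nf|m_h)\le e^{-\kappa_1 n\tau}\,\mathcal H^{\phi_1}(f|m_h).$$ -/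

import Mathlib

open MeasureTheory
open scoped Matrix InnerProductSpace

noncomputable section

namespace FokkerPlanckScheme

/-- The cube `D = [-K, K]^d`. -/
def cube (d : ℕ) (K : ℝ) : Set (EuclideanSpace ℝ (Fin d)) :=
  {x | ∀ j, x j ∈ Set.Icc (-K) K}

/-- Indices of the cells of the grid: multi-indices `(n_1, …, n_d)` with `n_j ∈ {1, …, N}`,
where `N = 2 K / h`. They enumerate the set `𝒦_h` of cell centers, see `center`. -/
def grid (d N : ℕ) : Finset (Fin d → ℤ) :=
  Fintype.piFinset fun _ => Finset.Icc (1 : ℤ) N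

/-- The state space of the Markov chain. -/
abbrev Cell (d N : ℕ) : Type := {n : Fin d → ℤ // n ∈ grid d N}

/-- The cell center `i` with `i_j = -K + h n_j - h / 2`. -/
def center {d : ℕ} (K h : ℝ) (n : Fin d → ℤ) : EuclideanSpace ℝ (Fin d) :=
  WithLp.toLp 2 fun j => -K + h * (n j : ℝ) - h / 2

/-- The moves `±_j`, as pairs of a direction `j` and a sign. -/
abbrev Move (d : ℕ) : Type := Fin d × ℤˣ

/-- The index of the cell `γ i`: for `γ = ±_j` the center `i` is moved to `i ± h e_j`. -/
def move {d : ℕ} (γ : Move d) (n : Fin d → ℤ) : Fin d → ℤ :=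
  n + Pi.single γ.1 (γ.2 : ℤ)

/-- The mean value `V^h(i) = h^{-d} ∫_{[-h/2,h/2]^d} V(i + s) ds` of `V` over a cell. -/
def meanV {d : ℕ} (K h : ℝ) (V : EuclideanSpace ℝ (Fin d) → ℝ) (n : Fin d → ℤ) : ℝ :=
  (h ^ d)⁻¹ * ∫ s in {s : EuclideanSpace ℝ (Fin d) | ∀ j, s j ∈ Set.Icc (-(h / 2)) (h / 2)},
    V (center K h n + s)

/-- The transition rate `c(i, γ)`: it is
`(σ² / h²) exp (-(V^h(γ i) - V^h(i)) / (2 σ²))` if `γ i` is in the grid, and `0` otherwise. -/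
def rate {d : ℕ} (N : ℕ) (K h σ : ℝ) (V : EuclideanSpace ℝ (Fin d) → ℝ)
    (n : Fin d → ℤ) (γ : Move d) : ℝ :=
  if move γ n ∈ grid d N then
    σ ^ 2 / h ^ 2 * Real.exp (-(meanV K h V (move γ n) - meanV K h V n) / (2 * σ ^ 2))
  else 0

/-- `𝒯 = 2 max_i ∑_γ c(i, γ)`. -/
def totalRate {d : ℕ} (N : ℕ) (K h σ : ℝ) (V : EuclideanSpace ℝ (Fin d) → ℝ) : ℝ :=
  2 * ⨆ i : Cell d N, ∑ γ : Move d, rate N K h σ V i.1 γ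

/-- The time step `τ = 1 / 𝒯`. -/
def timeStep {d : ℕ} (N : ℕ) (K h σ : ℝ) (V : EuclideanSpace ℝ (Fin d) → ℝ) : ℝ :=
  (totalRate N K h σ V)⁻¹

/-- The transition matrix `π` of the discrete-time Markov chain: `π(i, γ i) = c(i, γ) / 𝒯`,
`π(i, i) = 1 - ∑_γ c(i, γ) / 𝒯`, and `0` otherwise. For `k ≠ i` at most one move `γ` has
`γ i = k`, so that the sum below has at most one non-zero term. -/
def transition {d : ℕ} (N : ℕ) (K h σ : ℝ) (V : EuclideanSpace ℝ (Fin d) → ℝ) :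
    Matrix (Cell d N) (Cell d N) ℝ :=
  fun i k =>
    if k = i then 1 - ∑ γ : Move d, rate N K h σ V i.1 γ / totalRate N K h σ V
    else ∑ γ : Move d, if k.1 = move γ i.1 then rate N K h σ V i.1 γ / totalRate N K h σ V else 0

/-- The invariant measure `m_h(i) = Z⁻¹ exp (-V^h(i) / σ²)`. -/
def invMeasure {d : ℕ} (N : ℕ) (K h σ : ℝ) (V : EuclideanSpace ℝ (Fin d) → ℝ)
    (i : Cell d N) : ℝ :=
  (∑ k : Cell d N, Real.exp (-meanV K h V k.1 / σ ^ 2))⁻¹ *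
    Real.exp (-meanV K h V i.1 / σ ^ 2)

/-- `κ_±(i, j)`, with `γ = ±_j`:
`c(i, γ) - c(γ i, γ) - ∑_{γ' ≠ ±_j} max {c(γ i, γ') - c(i, γ'), 0}`. -/
def kappaMove {d : ℕ} (N : ℕ) (K h σ : ℝ) (V : EuclideanSpace ℝ (Fin d) → ℝ)
    (n : Fin d → ℤ) (γ : Move d) : ℝ :=
  rate N K h σ V n γ - rate N K h σ V (move γ n) γ
    - ∑ γ' : Move d with γ'.1 ≠ γ.1,
        max (rate N K h σ V (move γ n) γ' - rate N K h σ V n γ') 0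

/-- `κ_1 = min (κ_+(i, j) + κ_-(i + h e_j, j))`, the minimum over all `j` and all `i` such that
`i` and `i + h e_j` are in the grid. -/
def kappaOne {d : ℕ} (N : ℕ) (K h σ : ℝ) (V : EuclideanSpace ℝ (Fin d) → ℝ) : ℝ :=
  sInf {r | ∃ (n : Fin d → ℤ) (j : Fin d), n ∈ grid d N ∧ move (j, 1) n ∈ grid d N ∧
    r = kappaMove N K h σ V n (j, 1) + kappaMove N K h σ V (move (j, 1) n) (j, -1)}

/-- Strong convexity of `V` on `D`. -/
def AssumptionA2 {d : ℕ} (K : ℝ) (V : EuclideanSpace ℝ (Fin d) → ℝ) : Prop :=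
  ∃ κ : ℝ, 0 < κ ∧ ∀ x ∈ cube d K, ∀ y ∈ cube d K,
    κ * ‖x - y‖ ^ 2 ≤ ⟪x - y, gradient V x - gradient V y⟫_ℝ

/-- `κ_±(i, j) > 0` whenever `i` and `i ± h e_j` are in the grid. -/
def AssumptionA3 {d : ℕ} (N : ℕ) (K h σ : ℝ) (V : EuclideanSpace ℝ (Fin d) → ℝ) : Prop :=
  ∀ n ∈ grid d N, ∀ γ : Move d, move γ n ∈ grid d N → 0 < kappaMove N K h σ V n γ

/-- Additive potentials: `V(i) = ∑_j V_j(i_j)` for all cell centers `i`. -/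
def IsAdditive {d : ℕ} (N : ℕ) (K h : ℝ) (V : EuclideanSpace ℝ (Fin d) → ℝ) : Prop :=
  ∃ W : Fin d → ℝ → ℝ, ∀ n ∈ grid d N, V (center K h n) = ∑ j, W j (center K h n j)

/-- The Boltzmann entropy density `φ_1(x) = x log x - x + 1` (with `0 log 0 = 0`). -/
def phiOne (x : ℝ) : ℝ := x * Real.log x - x + 1

/-- The `φ`-entropy `ℋ^φ(f|m) = ∑_i φ(f(i)) m(i) - φ(∑_i f(i) m(i))`. -/
def phiEntropy {ι : Type*} [Fintype ι] (φ : ℝ → ℝ) (f m : ι → ℝ) : ℝ :=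
  ∑ i, φ (f i) * m i - φ (∑ i, f i * m i)

end FokkerPlanckScheme

end

open FokkerPlanckScheme

/-!
It suffices to treat one step: the entropy of `π f` is at most `1 - κ₁ τ` times the entropy of `f`,
and `1 - κ₁ τ ≤ exp (-κ₁ τ)`.

For a reversible chain the entropy is the integral of the entropy production
`∑ m(i) π(i,k) (f(i) - f(k)) (log f(i) - log f(k)) / 2` along the continuous-time semigroup
`exp (t (π - 1))`. Since this semigroup commutes with `π`, it is enough that one step of `π`
contracts the entropy production by the factor `1 - κ₁ τ` (`phiEntropy_mulVec_le`). The same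
contraction for the Dirichlet form, in which `(a - b) ^ 2` takes the place of
`(a - b) (log a - log b)`, shows that the semigroup converges to equilibrium (`tendsto_flow`), so
that no entropy is left at infinity.

Both functionals have the form `∑ m(i) c(i,γ) G(f(i), f(γ i))` with `G` jointly convex, symmetric
and zero on the diagonal. They are contracted by a coupling of the chains started at the two ends
of an edge `(i, γ i)` (`eulerStep_edge_le`): in each jump of the coupled chains the pair stays an
edge or coalesces, and coalescence occurs at rate at least `κ₁`. The induced dynamics on edges is
reversible with respect to the weights `m(i) c(i,γ)` (`IsGridRates.joint_moves`,
`IsGridRates.first_excess`, `IsGridRates.second_excess`, `IsGridRates.forward_moves`,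
`IsGridRates.backward_moves`), so that summing over all edges leaves only the loss by coalescence
(`gridEdgeSum_eulerStep_le`). The factor `2` in `𝒯` ensures that the total jump rate of a coupled
pair is at most `𝒯 = 1 / τ`.

Reversibility on edges rests on detailed balance and on the exchange relation
`c(n,γ) c(γ n,γ') = c(n,γ') c(γ' n,γ)` for moves in different directions. Both hold for rates of the
form `C exp (U(n) - U(γ n))`, where `U` is the cell mean of `V` divided by `2 σ²`.
-/

namespace FokkerPlanckScheme

/-! ### Entropy contraction for finite reversible chains -/

section ReversibleChain

open Filter Topology

variable {ι : Type*} [Fintype ι]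

/-- A stochastic matrix `P` that satisfies the detailed balance relation with respect to a
strictly positive probability vector `m`. -/
structure IsReversibleChain (P : Matrix ι ι ℝ) (m : ι → ℝ) : Prop where
  nonneg : ∀ i j, 0 ≤ P i j
  row_sum : ∀ i, ∑ j, P i j = 1
  pos : ∀ i, 0 < m i
  sum_eq_one : ∑ i, m i = 1
  balance : ∀ i j, m i * P i j = m j * P j i

/-- The edge functional `∑ m(i) P(i,j) G(f(i), f(j))`. -/
def edgeSum (P : Matrix ι ι ℝ) (m : ι → ℝ) (G : ℝ → ℝ → ℝ) (f : ι → ℝ) : ℝ :=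
  ∑ i, ∑ j, m i * P i j * G (f i) (f j)

/-- The integrand `(a - b) (log a - log b)` of the entropy production. -/
noncomputable def logGap (a b : ℝ) : ℝ := (a - b) * (Real.log a - Real.log b)

/-- The integrand `(a - b) ^ 2` of the Dirichlet form. -/
def sqGap (a b : ℝ) : ℝ := (a - b) ^ 2

variable {P : Matrix ι ι ℝ} {m : ι → ℝ}

theorem IsReversibleChain.sum_mulVec (hP : IsReversibleChain P m) (f : ι → ℝ) :
    ∑ i, m i * (P *ᵥ f) i = ∑ i, m i * f i := by
  simp only [Matrix.mulVec, dotProduct, Finset.mul_sum]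
  rw [Finset.sum_comm]
  refine Finset.sum_congr rfl fun j _ => ?_
  calc ∑ i, m i * (P i j * f j) = ∑ i, m j * f j * P j i :=
        Finset.sum_congr rfl fun i _ => by linear_combination f j * hP.balance i j
    _ = m j * f j := by rw [← Finset.mul_sum, hP.row_sum, mul_one]

theorem IsReversibleChain.mulVec_sub (hP : IsReversibleChain P m) (f : ι → ℝ) (i : ι) :
    (P *ᵥ f) i - f i = ∑ j, P i j * (f j - f i) := by
  simp only [mul_sub, Finset.sum_sub_distrib, ← Finset.sum_mul, hP.row_sum, one_mul]
  rfl

/-- Summation by parts for a reversible chain. -/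
theorem IsReversibleChain.sum_mul_mulVec_sub (hP : IsReversibleChain P m) (u v : ι → ℝ) :
    ∑ i, m i * u i * ((P *ᵥ v) i - v i) =
      -(1 / 2) * ∑ i, ∑ j, m i * P i j * ((v i - v j) * (u i - u j)) := by
  have h1 : ∑ i, m i * u i * ((P *ᵥ v) i - v i) =
      ∑ i, ∑ j, m i * P i j * (u i * (v j - v i)) :=
    Finset.sum_congr rfl fun i _ => by
      rw [hP.mulVec_sub, Finset.mul_sum]
      exact Finset.sum_congr rfl fun j _ => by ring
  have h2 : ∑ i, ∑ j, m i * P i j * (u i * (v j - v i)) =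
      ∑ i, ∑ j, m i * P i j * (u j * (v i - v j)) := by
    rw [Finset.sum_comm]
    exact Finset.sum_congr rfl fun i _ => Finset.sum_congr rfl fun j _ => by
      rw [hP.balance j i]
  have h3 : ∑ i, ∑ j, m i * P i j * ((v i - v j) * (u i - u j)) =
      -(∑ i, ∑ j, m i * P i j * (u i * (v j - v i)) +
        ∑ i, ∑ j, m i * P i j * (u j * (v i - v j))) := by
    simp only [← Finset.sum_add_distrib, ← Finset.sum_neg_distrib]
    exact Finset.sum_congr rfl fun i _ => Finset.sum_congr rfl fun j _ => by ring
  rw [h1, h3, ← h2]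
  ring

theorem IsReversibleChain.mulVec_pos (hP : IsReversibleChain P m) {f : ι → ℝ}
    (hf : ∀ i, 0 < f i) (i : ι) : 0 < (P *ᵥ f) i := by
  refine lt_of_le_of_ne (Finset.sum_nonneg fun j _ => mul_nonneg (hP.nonneg i j) (hf j).le) ?_
  intro h0
  have h := (Finset.sum_eq_zero_iff_of_nonneg
    fun j _ => mul_nonneg (hP.nonneg i j) (hf j).le).1 h0.symm
  have h1 := hP.row_sum i
  rw [Finset.sum_eq_zero fun j hj => (mul_eq_zero.1 (h j hj)).resolve_right (hf j).ne'] at h1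
  exact zero_ne_one h1

theorem phiEntropy_phiOne_nonneg (hm : ∀ i, 0 ≤ m i) (hm1 : ∑ i, m i = 1) {f : ι → ℝ}
    (hf : ∀ i, 0 ≤ f i) : 0 ≤ phiEntropy phiOne f m := by
  have h := Real.convexOn_mul_log.map_sum_le (t := Finset.univ) (w := m) (p := f)
    (fun i _ => hm i) hm1 fun i _ => hf i
  simp only [smul_eq_mul] at h
  have hm' : ∑ i, f i * m i = ∑ i, m i * f i :=
    Finset.sum_congr rfl fun i _ => mul_comm _ _
  have e : ∑ i, phiOne (f i) * m i =
      ∑ i, m i * (f i * Real.log (f i)) - ∑ i, m i * f i + 1 := by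
    rw [← hm1, ← Finset.sum_sub_distrib, ← Finset.sum_add_distrib]
    exact Finset.sum_congr rfl fun i _ => by rw [phiOne]; ring
  rw [phiEntropy, e, hm', phiOne]
  linarith

variable [DecidableEq ι]

section Flow

open scoped Matrix.Norms.Operator

/-- The continuous-time semigroup `exp (t (P - 1)) f` of the chain that jumps according to `P` at
rate `1`. -/
noncomputable def flow (P : Matrix ι ι ℝ) (f : ι → ℝ) (t : ℝ) : ι → ℝ :=
  NormedSpace.exp (t • (P - 1)) *ᵥ f

theorem flow_zero (f : ι → ℝ) : flow P f 0 = f := by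
  simp [flow]

theorem flow_mulVec (f : ι → ℝ) (t : ℝ) : flow P (P *ᵥ f) t = P *ᵥ flow P f t := by
  have h : Commute P (t • (P - 1)) :=
    ((Commute.refl P).sub_right (Commute.one_right P)).smul_right t
  simp only [flow, Matrix.mulVec_mulVec]
  rw [(h.exp_right).eq]

theorem hasDerivAt_flow (f : ι → ℝ) (i : ι) (t : ℝ) :
    HasDerivAt (fun s => flow P f s i) ((P *ᵥ flow P f t) i - flow P f t i) t := by
  have h := hasDerivAt_exp_smul_const' (𝕂 := ℝ) (P - 1) t
  let Λ : Matrix ι ι ℝ →ₗ[ℝ] ℝ :=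
    { toFun := fun M => (M *ᵥ f) i
      map_add' := fun M M' => by simp [Matrix.add_mulVec]
      map_smul' := fun a M => by simp [Matrix.smul_mulVec] }
  have h' := (Λ.toContinuousLinearMap.hasFDerivAt).comp_hasDerivAt t h
  have e : (P *ᵥ flow P f t) i - flow P f t i =
      Λ.toContinuousLinearMap ((P - 1) * NormedSpace.exp (t • (P - 1))) := by
    simp [Λ, flow, sub_mul, Matrix.sub_mulVec, Matrix.mulVec_mulVec]
  rw [e]
  exact h'

theorem flow_pos (hP : ∀ i j, 0 ≤ P i j) {f : ι → ℝ} (hf : ∀ i, 0 < f i) {t : ℝ} (ht : 0 ≤ t)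
    (i : ι) : 0 < flow P f t i := by
  -- `exp (t (P - 1)) = exp (-t) exp (t P)`, and the exponential series of `t P` has only
  -- non-negative terms
  have hsplit : NormedSpace.exp (t • (P - 1)) = Real.exp (-t) • NormedSpace.exp (t • P) := by
    have h1 : t • (P - 1) = t • P + (-t) • (1 : Matrix ι ι ℝ) := by
      rw [smul_sub, neg_smul, sub_eq_add_neg]
    have hc : Commute (t • P) ((-t) • (1 : Matrix ι ι ℝ)) :=
      (Commute.one_right _).smul_right _
    have h2 : NormedSpace.exp ((-t) • (1 : Matrix ι ι ℝ)) = Real.exp (-t) • 1 := by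
      have h3 := NormedSpace.algebraMap_exp_comm (𝕂 := ℝ) (𝔸 := Matrix ι ι ℝ) (-t)
      rw [← Real.exp_eq_exp_ℝ, Algebra.algebraMap_eq_smul_one,
        Algebra.algebraMap_eq_smul_one] at h3
      exact h3.symm
    rw [h1, Matrix.exp_add_of_commute _ _ hc, h2, mul_smul_comm, mul_one]
  let Λ : Matrix ι ι ℝ →ₗ[ℝ] ℝ :=
    { toFun := fun M => (M *ᵥ f) i
      map_add' := fun M M' => by simp [Matrix.add_mulVec]
      map_smul' := fun a M => by simp [Matrix.smul_mulVec] }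
  have hs := (NormedSpace.exp_series_hasSum_exp' (𝕂 := ℝ) (t • P)).mapL Λ.toContinuousLinearMap
  have hpow : ∀ n : ℕ, ∀ j, 0 ≤ (P ^ n *ᵥ f) j := by
    intro n
    induction n with
    | zero => intro j; simpa using (hf j).le
    | succ n ih =>
      intro j
      rw [pow_succ', ← Matrix.mulVec_mulVec]
      exact Finset.sum_nonneg fun k _ => mul_nonneg (hP j k) (ih k)
  have hterm : ∀ n : ℕ, 0 ≤ Λ.toContinuousLinearMap (((n.factorial : ℝ)⁻¹) • (t • P) ^ n) := by
    intro n
    simp only [smul_pow, map_smul, smul_eq_mul]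
    exact mul_nonneg (by positivity) (mul_nonneg (by positivity) (hpow n i))
  have h0 := hs.summable.sum_le_tsum {0} fun n _ => hterm n
  rw [hs.tsum_eq] at h0
  have h0' : f i ≤ (NormedSpace.exp (t • P) *ᵥ f) i :=
    le_trans (le_of_eq (by simp [Λ])) h0
  rw [flow, hsplit, Matrix.smul_mulVec]
  exact mul_pos (Real.exp_pos _) ((hf i).trans_le h0')

end Flow

theorem IsReversibleChain.sum_flow (hP : IsReversibleChain P m) (f : ι → ℝ) (t : ℝ) :
    ∑ i, m i * flow P f t i = ∑ i, m i * f i := by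
  have hd : ∀ s, HasDerivAt (fun s => ∑ i, m i * flow P f s i) 0 s := by
    intro s
    have h := HasDerivAt.fun_sum (u := Finset.univ)
      fun i _ => (hasDerivAt_flow (P := P) f i s).const_mul (m i)
    refine h.congr_deriv ?_
    simp only [mul_sub, Finset.sum_sub_distrib]
    rw [hP.sum_mulVec, sub_self]
  have h := is_const_of_deriv_eq_zero (fun s => (hd s).differentiableAt)
    (fun s => (hd s).deriv) t 0
  simpa [flow_zero] using h

/-- Contraction of the Dirichlet form in one step of `P` gives exponential decay along the
semigroup. -/
theorem edgeSum_sqGap_flow_le (hP : IsReversibleChain P m) {r : ℝ}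
    (hsq : ∀ f, edgeSum P m sqGap (P *ᵥ f) ≤ r * edgeSum P m sqGap f) (f : ι → ℝ)
    {t : ℝ} (ht : 0 ≤ t) :
    edgeSum P m sqGap (flow P f t) ≤ Real.exp (-((1 - r) * t)) * edgeSum P m sqGap f := by
  -- the derivative of the Dirichlet form at `v` in the direction `w`
  let B : (ι → ℝ) → (ι → ℝ) → ℝ := fun v w =>
    ∑ i, ∑ j, m i * P i j * (2 * (v i - v j) * (w i - w j))
  have hd : ∀ s, HasDerivAt (fun s => edgeSum P m sqGap (flow P f s))
      (B (flow P f s) (fun i => (P *ᵥ flow P f s) i - flow P f s i)) s := by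
    intro s
    refine HasDerivAt.fun_sum fun i _ => HasDerivAt.fun_sum fun j _ => ?_
    have h := (((hasDerivAt_flow (P := P) f i s).sub (hasDerivAt_flow (P := P) f j s)).pow
      2).const_mul (m i * P i j)
    refine h.congr_deriv ?_
    simp
  have hB : ∀ v, B v (fun i => (P *ᵥ v) i - v i) ≤ -(1 - r) * edgeSum P m sqGap v := by
    intro v
    have e : edgeSum P m sqGap (P *ᵥ v) = edgeSum P m sqGap v +
        B v (fun i => (P *ᵥ v) i - v i) +
        edgeSum P m sqGap (fun i => (P *ᵥ v) i - v i) := by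
      simp only [edgeSum, B, ← Finset.sum_add_distrib]
      refine Finset.sum_congr rfl fun i _ => Finset.sum_congr rfl fun j _ => ?_
      simp only [sqGap]
      ring
    -- the Dirichlet form is quadratic, and the second-order term of its expansion is non-negative
    have hn : 0 ≤ edgeSum P m sqGap (fun i => (P *ᵥ v) i - v i) :=
      Finset.sum_nonneg fun i _ => Finset.sum_nonneg fun j _ =>
        mul_nonneg (mul_nonneg (hP.pos i).le (hP.nonneg i j)) (sq_nonneg _)
    have := hsq v
    linarith
  have hprod : ∀ s, HasDerivAt (fun s => Real.exp ((1 - r) * s) * edgeSum P m sqGap (flow P f s))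
      (Real.exp ((1 - r) * s) * ((1 - r) * 1) * edgeSum P m sqGap (flow P f s) +
        Real.exp ((1 - r) * s) *
          B (flow P f s) (fun i => (P *ᵥ flow P f s) i - flow P f s i)) s :=
    fun s => (((hasDerivAt_id s).const_mul (1 - r)).exp).mul (hd s)
  have hanti : Antitone fun s => Real.exp ((1 - r) * s) * edgeSum P m sqGap (flow P f s) := by
    refine antitone_of_deriv_nonpos (fun s => (hprod s).differentiableAt) fun s => ?_
    rw [(hprod s).deriv]
    have h1 := mul_le_mul_of_nonneg_left (hB (flow P f s)) (Real.exp_pos ((1 - r) * s)).le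
    linarith
  have h := hanti ht
  simp only [mul_zero, Real.exp_zero, one_mul, flow_zero] at h
  rw [Real.exp_neg, ← div_eq_inv_mul, le_div_iff₀ (Real.exp_pos _), mul_comm]
  exact h

theorem tendsto_flow (hP : IsReversibleChain P m) {r : ℝ} (hr : r < 1)
    (hsq : ∀ f, edgeSum P m sqGap (P *ᵥ f) ≤ r * edgeSum P m sqGap f)
    (hirr : ∀ i j, Relation.ReflTransGen (fun i j => 0 < P i j) i j) (f : ι → ℝ) (i : ι) :
    Tendsto (fun t => flow P f t i) atTop (𝓝 (∑ j, m j * f j)) := by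
  have hE : Tendsto (fun t => edgeSum P m sqGap (flow P f t)) atTop (𝓝 0) := by
    have hlim : Tendsto (fun t => Real.exp (-((1 - r) * t)) * edgeSum P m sqGap f) atTop
        (𝓝 (0 * edgeSum P m sqGap f)) :=
      (Real.tendsto_exp_neg_atTop_nhds_zero.comp
        (tendsto_id.const_mul_atTop (sub_pos.2 hr))).mul_const _
    rw [zero_mul] at hlim
    refine tendsto_of_tendsto_of_tendsto_of_le_of_le' tendsto_const_nhds hlim
      (Eventually.of_forall fun t => Finset.sum_nonneg fun i _ => Finset.sum_nonneg fun j _ =>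
        mul_nonneg (mul_nonneg (hP.pos i).le (hP.nonneg i j)) (sq_nonneg _)) ?_
    filter_upwards [eventually_ge_atTop 0] with t ht using edgeSum_sqGap_flow_le hP hsq f ht
  have hedge : ∀ i j, 0 < P i j →
      Tendsto (fun t => flow P f t i - flow P f t j) atTop (𝓝 0) := by
    intro i j hij
    have hc : 0 < m i * P i j := mul_pos (hP.pos i) hij
    have hsq0 : Tendsto (fun t => (flow P f t i - flow P f t j) ^ 2) atTop (𝓝 0) := by
      have hlim := hE.const_mul (m i * P i j)⁻¹
      rw [mul_zero] at hlim
      refine squeeze_zero (fun t => sq_nonneg _) (fun t => ?_) hlim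
      rw [← div_eq_inv_mul, le_div_iff₀ hc, mul_comm]
      have hnn : ∀ i j, 0 ≤ m i * P i j * sqGap (flow P f t i) (flow P f t j) := fun i j =>
        mul_nonneg (mul_nonneg (hP.pos i).le (hP.nonneg i j)) (sq_nonneg _)
      calc m i * P i j * (flow P f t i - flow P f t j) ^ 2
          ≤ ∑ j, m i * P i j * sqGap (flow P f t i) (flow P f t j) :=
            Finset.single_le_sum (fun j _ => hnn i j) (Finset.mem_univ j)
        _ ≤ _ := Finset.single_le_sum
            (f := fun i => ∑ j, m i * P i j * sqGap (flow P f t i) (flow P f t j))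
            (fun i _ => Finset.sum_nonneg fun j _ => hnn i j) (Finset.mem_univ i)
    have h := hsq0.sqrt
    simp only [Real.sqrt_sq_eq_abs, Real.sqrt_zero] at h
    exact (tendsto_zero_iff_abs_tendsto_zero _).2 h
  have hpair : ∀ i j, Tendsto (fun t => flow P f t i - flow P f t j) atTop (𝓝 0) := by
    intro i j
    induction hirr i j with
    | refl => simp
    | tail _ hbc ih => simpa using ih.add (hedge _ _ hbc)
  have hsum : Tendsto (fun t => ∑ j, m j * (flow P f t i - flow P f t j)) atTop
      (𝓝 (∑ j, m j * 0)) :=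
    tendsto_finsetSum _ fun j _ => (hpair i j).const_mul _
  have h := hsum.add_const (∑ j, m j * f j)
  simp only [mul_zero, Finset.sum_const_zero, zero_add] at h
  refine h.congr fun t => ?_
  simp only [mul_sub, Finset.sum_sub_distrib, ← Finset.sum_mul, hP.sum_eq_one, hP.sum_flow]
  ring

theorem continuous_phiOne : Continuous phiOne :=
  (Real.continuous_mul_log.sub continuous_id).add continuous_const

theorem hasDerivAt_phiOne {x : ℝ} (hx : 0 < x) : HasDerivAt phiOne (Real.log x) x := by
  have h := ((Real.hasDerivAt_mul_log hx.ne').sub (hasDerivAt_id x)).add_const 1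
  refine h.congr_deriv ?_
  simp

/-- The entropy production identity along the semigroup. -/
theorem hasDerivAt_sum_phiOne_flow (hP : IsReversibleChain P m) {f : ι → ℝ} (hf : ∀ i, 0 < f i)
    {t : ℝ} (ht : 0 ≤ t) :
    HasDerivAt (fun s => ∑ i, phiOne (flow P f s i) * m i)
      (-(1 / 2) * edgeSum P m logGap (flow P f t)) t := by
  have h := HasDerivAt.fun_sum (u := Finset.univ) fun i _ =>
    ((hasDerivAt_phiOne (flow_pos hP.nonneg hf ht i)).comp t
      (hasDerivAt_flow (P := P) f i t)).mul_const (m i)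
  refine h.congr_deriv ?_
  have h' := hP.sum_mul_mulVec_sub (fun i => Real.log (flow P f t i)) (flow P f t)
  simp only [edgeSum, logGap]
  rw [← h']
  exact Finset.sum_congr rfl fun i _ => by ring

theorem phiEntropy_mulVec_le_of_pos (hP : IsReversibleChain P m) {r : ℝ} (hr : r < 1)
    (hlog : ∀ f, (∀ i, 0 < f i) → edgeSum P m logGap (P *ᵥ f) ≤ r * edgeSum P m logGap f)
    (hsq : ∀ f, edgeSum P m sqGap (P *ᵥ f) ≤ r * edgeSum P m sqGap f)
    (hirr : ∀ i j, Relation.ReflTransGen (fun i j => 0 < P i j) i j)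
    {f : ι → ℝ} (hf : ∀ i, 0 < f i) :
    phiEntropy phiOne (P *ᵥ f) m ≤ r * phiEntropy phiOne f m := by
  have hPf : ∀ i, 0 < (P *ᵥ f) i := hP.mulVec_pos hf
  -- `F` is non-decreasing because its derivative compares the two entropy productions
  let F : ℝ → ℝ := fun t => ∑ i, phiOne (flow P (P *ᵥ f) t i) * m i -
    r * ∑ i, phiOne (flow P f t i) * m i
  have hd : ∀ t, 0 ≤ t → HasDerivAt F (-(1 / 2) * edgeSum P m logGap (flow P (P *ᵥ f) t) -
      r * (-(1 / 2) * edgeSum P m logGap (flow P f t))) t := fun t ht =>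
    (hasDerivAt_sum_phiOne_flow hP hPf ht).sub
      ((hasDerivAt_sum_phiOne_flow hP hf ht).const_mul r)
  have hmono : MonotoneOn F (Set.Ici 0) := by
    refine monotoneOn_of_deriv_nonneg (convex_Ici 0)
      (fun t ht => (hd t ht).continuousAt.continuousWithinAt)
      (fun t ht => ?_) (fun t ht => ?_)
    · rw [interior_Ici] at ht
      exact (hd t (le_of_lt ht)).differentiableAt.differentiableWithinAt
    · rw [interior_Ici] at ht
      rw [(hd t (le_of_lt ht)).deriv, flow_mulVec]
      have := hlog (flow P f t) fun i => flow_pos hP.nonneg hf (le_of_lt ht) i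
      linarith
  have hlim : ∀ g : ι → ℝ, Tendsto (fun t => ∑ i, phiOne (flow P g t i) * m i) atTop
      (𝓝 (phiOne (∑ j, m j * g j))) := by
    intro g
    have h : Tendsto (fun t => ∑ i, phiOne (flow P g t i) * m i) atTop
        (𝓝 (∑ i, phiOne (∑ j, m j * g j) * m i)) := tendsto_finsetSum _ fun i _ =>
      (((continuous_phiOne.tendsto _).comp (tendsto_flow hP hr hsq hirr g i))).mul_const _
    rwa [← Finset.mul_sum, hP.sum_eq_one, mul_one] at h
  have hF := (hlim (P *ᵥ f)).sub ((hlim f).const_mul r)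
  rw [hP.sum_mulVec] at hF
  have h0 : F 0 ≤ phiOne (∑ j, m j * f j) - r * phiOne (∑ j, m j * f j) := by
    refine ge_of_tendsto hF ?_
    filter_upwards [eventually_ge_atTop 0] with t ht using
      hmono (Set.mem_Ici.2 le_rfl) (Set.mem_Ici.2 ht) ht
  simp only [F, flow_zero] at h0
  have hm : ∑ i, (P *ᵥ f) i * m i = ∑ i, m i * f i := by
    rw [← hP.sum_mulVec]
    exact Finset.sum_congr rfl fun i _ => mul_comm _ _
  have hm' : ∑ i, f i * m i = ∑ i, m i * f i :=
    Finset.sum_congr rfl fun i _ => mul_comm _ _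
  rw [phiEntropy, phiEntropy, hm, hm']
  linarith

/-- If one step of a reversible irreducible chain contracts both the entropy production and the
Dirichlet form by the factor `r < 1`, then it contracts the entropy by `r`. The entropy is the
integral of the entropy production along the continuous-time semigroup, which commutes with
`P`. -/
theorem phiEntropy_mulVec_le (hP : IsReversibleChain P m) {r : ℝ} (hr : r < 1)
    (hlog : ∀ f, (∀ i, 0 < f i) → edgeSum P m logGap (P *ᵥ f) ≤ r * edgeSum P m logGap f)
    (hsq : ∀ f, edgeSum P m sqGap (P *ᵥ f) ≤ r * edgeSum P m sqGap f)
    (hirr : ∀ i j, Relation.ReflTransGen (fun i j => 0 < P i j) i j)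
    {f : ι → ℝ} (hf : ∀ i, 0 ≤ f i) :
    phiEntropy phiOne (P *ᵥ f) m ≤ r * phiEntropy phiOne f m := by
  have hcont : ∀ g : ι → ℝ, Tendsto (fun ε : ℝ => phiEntropy phiOne (fun i => g i + ε) m)
      (𝓝[>] 0) (𝓝 (phiEntropy phiOne g m)) := by
    intro g
    have hc : Continuous fun ε : ℝ => phiEntropy phiOne (fun i => g i + ε) m := by
      have := continuous_phiOne
      unfold phiEntropy
      fun_prop
    have h := hc.tendsto 0
    simp only [add_zero] at h
    exact h.mono_left nhdsWithin_le_nhds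
  -- apply the bound for positive functions to `f + ε` and let `ε` tend to zero
  refine le_of_tendsto_of_tendsto (hcont _) ((hcont f).const_mul r) ?_
  filter_upwards [self_mem_nhdsWithin] with ε hε
  have h := phiEntropy_mulVec_le_of_pos hP hr hlog hsq hirr
    (f := fun i => f i + ε) fun i => add_pos_of_nonneg_of_pos (hf i) hε
  have e : P *ᵥ (fun i => f i + ε) = fun i => (P *ᵥ f) i + ε := by
    funext i
    simp only [Matrix.mulVec, dotProduct, mul_add, Finset.sum_add_distrib, ← Finset.sum_mul,
      hP.row_sum, one_mul]
  rwa [e] at h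

end ReversibleChain

/-! ### Sums over the edges of the grid and the coupling -/

section Grid

variable {d N : ℕ}

/-- The move opposite to `γ`. -/
def invMove (γ : Move d) : Move d := (γ.1, -γ.2)

@[simp] theorem invMove_fst (γ : Move d) : (invMove γ).1 = γ.1 := rfl

@[simp] theorem invMove_invMove (γ : Move d) : invMove (invMove γ) = γ := by
  simp [invMove]

theorem invMove_involutive : Function.Involutive (invMove (d := d)) := invMove_invMove

theorem move_comm (γ γ' : Move d) (n : Fin d → ℤ) :
    move γ (move γ' n) = move γ' (move γ n) := by
  simp only [move]
  abel

@[simp] theorem move_invMove_move (γ : Move d) (n : Fin d → ℤ) :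
    move (invMove γ) (move γ n) = n := by
  simp only [move, invMove, Units.val_neg, Pi.single_neg]
  abel

@[simp] theorem move_move_invMove (γ : Move d) (n : Fin d → ℤ) :
    move γ (move (invMove γ) n) = n := by
  rw [move_comm, move_invMove_move]

theorem move_ne (γ : Move d) (n : Fin d → ℤ) : move γ n ≠ n := by
  intro h
  simp only [move, add_eq_left, Pi.single_eq_zero_iff] at h
  exact γ.2.ne_zero h

theorem move_move_mem_grid_iff {n : Fin d → ℤ} (hn : n ∈ grid d N) {γ γ' : Move d}
    (hne : γ.1 ≠ γ'.1) :
    move γ' (move γ n) ∈ grid d N ↔ move γ n ∈ grid d N ∧ move γ' n ∈ grid d N := by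
  simp only [grid, Fintype.mem_piFinset, move, Pi.add_apply] at hn ⊢
  rw [← forall_and]
  refine forall_congr' fun k => ?_
  have hk := hn k
  by_cases h1 : k = γ.1
  · have h2 : k ≠ γ'.1 := fun h => hne (h1 ▸ h)
    simp [Pi.single_eq_of_ne h2, hk]
  · simp [Pi.single_eq_of_ne h1, hk]

theorem sum_move_eq (γ : Move d) (F : Move d → ℝ) :
    ∑ γ', F γ' = F γ + F (invMove γ) + ∑ γ' with γ'.1 ≠ γ.1, F γ' := by
  rw [← Finset.sum_filter_not_add_sum_filter Finset.univ (fun γ' : Move d => γ'.1 ≠ γ.1)]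
  congr 1
  have hne : γ ≠ invMove γ := fun h => by
    have h2 : γ.2 = -γ.2 := congrArg Prod.snd h
    exact units_ne_neg_self γ.2 h2
  rw [← Finset.sum_pair hne]
  refine Finset.sum_congr ?_ fun _ _ => rfl
  ext ⟨j, s⟩
  obtain ⟨k, t⟩ := γ
  simp only [Finset.mem_filter, Finset.mem_univ, true_and, not_not, Finset.mem_insert,
    Finset.mem_singleton, invMove, Prod.mk.injEq, ← and_or_left]
  refine ⟨fun h => ⟨h, ?_⟩, fun h => h.1⟩
  rcases Int.units_eq_one_or s with rfl | rfl <;> rcases Int.units_eq_one_or t with rfl | rfl <;>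
    simp

/-- Change of variables `n ↦ γ n` in a sum over the grid. -/
theorem sum_grid_move (γ : Move d) {F F' : (Fin d → ℤ) → ℝ}
    (h : ∀ n ∈ grid d N, move γ n ∈ grid d N → F n = F' (move γ n))
    (h0 : ∀ n ∈ grid d N, move γ n ∉ grid d N → F n = 0)
    (h1 : ∀ n ∈ grid d N, move (invMove γ) n ∉ grid d N → F' n = 0) :
    ∑ n ∈ grid d N, F n = ∑ n ∈ grid d N, F' n := by
  have hmem : ∀ n ∈ grid d N, F n ≠ 0 → move γ n ∈ grid d N := fun n hn hF =>
    by_contra fun hc => hF (h0 n hn hc)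
  refine Finset.sum_bij_ne_zero (fun n _ _ => move γ n) hmem ?_ ?_ ?_
  · intro a _ _ b _ _ hab
    simpa using congrArg (move (invMove γ)) hab
  · intro b hb hb0
    have hb' : move (invMove γ) b ∈ grid d N := by_contra fun hc => hb0 (h1 b hb hc)
    have e := h _ hb' (by simpa using hb)
    rw [move_move_invMove] at e
    exact ⟨_, hb', e ▸ hb0, move_move_invMove γ b⟩
  · intro a ha hF
    exact h a ha (hmem a ha hF)

/-- Sum over all pairs of moves in different directions. -/
def crossSum (F : Move d → Move d → ℝ) : ℝ :=
  ∑ γ : Move d, ∑ γ' : Move d with γ'.1 ≠ γ.1, F γ γ'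

theorem crossSum_congr {F F' : Move d → Move d → ℝ}
    (h : ∀ γ γ' : Move d, γ.1 ≠ γ'.1 → F γ γ' = F' γ γ') : crossSum F = crossSum F' :=
  Finset.sum_congr rfl fun γ _ => Finset.sum_congr rfl fun γ' h' =>
    h γ γ' (Finset.mem_filter.1 h').2.symm

theorem crossSum_swap (F : Move d → Move d → ℝ) :
    crossSum (fun γ γ' => F γ' γ) = crossSum F := by
  simp only [crossSum, Finset.sum_filter]
  rw [Finset.sum_comm]
  simp only [ne_comm]

theorem crossSum_inv_left (F : Move d → Move d → ℝ) :
    crossSum (fun γ γ' => F (invMove γ) γ') = crossSum F :=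
  Fintype.sum_equiv (invMove_involutive (d := d)).toPerm _ _ fun _ => rfl

theorem crossSum_inv_right (F : Move d → Move d → ℝ) :
    crossSum (fun γ γ' => F γ (invMove γ')) = crossSum F := by
  rw [← crossSum_swap, crossSum_inv_left (fun γ γ' => F γ' γ), crossSum_swap]

/-- Jump rates `c` on the grid that are reversible with respect to `mu` and for which the two
ways to perform two moves in different directions have the same weight. -/
structure IsGridRates (N : ℕ) (c : (Fin d → ℤ) → Move d → ℝ) (mu : (Fin d → ℤ) → ℝ) : Prop where
  nonneg : ∀ n γ, 0 ≤ c n γ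
  mu_nonneg : ∀ n, 0 ≤ mu n
  eq_zero : ∀ n γ, move γ n ∉ grid d N → c n γ = 0
  balance : ∀ n ∈ grid d N, ∀ γ, move γ n ∈ grid d N →
    mu n * c n γ = mu (move γ n) * c (move γ n) (invMove γ)
  exchange : ∀ n ∈ grid d N, ∀ γ γ' : Move d, γ.1 ≠ γ'.1 →
    c n γ * c (move γ n) γ' = c n γ' * c (move γ' n) γ

/-- The rate at which, in the coupling of two chains at `n` and `γ n`, the first one jumps onto the
second while the second does not move. For `c = rate N K h σ V` this is `kappaMove` by
definition. -/
def coalescenceRate (c : (Fin d → ℤ) → Move d → ℝ) (n : Fin d → ℤ) (γ : Move d) : ℝ :=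
  c n γ - c (move γ n) γ - ∑ γ' : Move d with γ'.1 ≠ γ.1, max (c (move γ n) γ' - c n γ') 0

/-- The functional `∑ mu(n) c(n, γ) G(g(n), g(γ n))` over the oriented edges of the grid. -/
noncomputable def gridEdgeSum (N : ℕ) (c : (Fin d → ℤ) → Move d → ℝ) (mu : (Fin d → ℤ) → ℝ)
    (G : ℝ → ℝ → ℝ) (g : (Fin d → ℤ) → ℝ) : ℝ :=
  ∑ n ∈ grid d N, ∑ γ, mu n * c n γ * G (g n) (g (move γ n))

/-- One Euler step `g + τ L g`, where `L` is the generator with rates `c`. -/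
def eulerStep (c : (Fin d → ℤ) → Move d → ℝ) (τ : ℝ) (g : (Fin d → ℤ) → ℝ) (n : Fin d → ℤ) : ℝ :=
  g n + τ * ∑ γ, c n γ * (g (move γ n) - g n)

/-- On `S × S`, the function `G` has a supporting affine function at every point. This is the
form in which joint convexity of `G` enters. -/
def HasAffineSupport (S : Set ℝ) (G : ℝ → ℝ → ℝ) : Prop :=
  ∀ a₀ ∈ S, ∀ b₀ ∈ S, ∃ α β δ : ℝ, G a₀ b₀ = α * a₀ + β * b₀ + δ ∧
    ∀ a ∈ S, ∀ b ∈ S, α * a + β * b + δ ≤ G a b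

theorem hasAffineSupport_sqGap : HasAffineSupport Set.univ sqGap := by
  refine fun a₀ _ b₀ _ => ⟨2 * (a₀ - b₀), -(2 * (a₀ - b₀)), -(a₀ - b₀) ^ 2, ?_, ?_⟩
  · simp only [sqGap]
    ring
  · intro a _ b _
    simp only [sqGap]
    nlinarith [sq_nonneg (a - b - (a₀ - b₀))]

theorem hasAffineSupport_logGap : HasAffineSupport (Set.Ioi 0) logGap := by
  intro a₀ (ha₀ : 0 < a₀) b₀ (hb₀ : 0 < b₀)
  -- the coefficients are the partial derivatives at `(a₀, b₀)`; the constant vanishes since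
  -- the function is homogeneous of degree one
  refine ⟨Real.log a₀ - Real.log b₀ + 1 - b₀ / a₀, Real.log b₀ - Real.log a₀ + 1 - a₀ / b₀, 0,
    ?_, ?_⟩
  · simp only [logGap]
    field_simp
    ring
  · intro a (ha : 0 < a) b (hb : 0 < b)
    have e1 : Real.log (b * a₀ / (a * b₀)) =
        Real.log b + Real.log a₀ - (Real.log a + Real.log b₀) := by
      rw [Real.log_div (by positivity) (by positivity), Real.log_mul hb.ne' ha₀.ne',
        Real.log_mul ha.ne' hb₀.ne']
    have e2 : Real.log (a * b₀ / (b * a₀)) =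
        Real.log a + Real.log b₀ - (Real.log b + Real.log a₀) := by
      rw [Real.log_div (by positivity) (by positivity), Real.log_mul hb.ne' ha₀.ne',
        Real.log_mul ha.ne' hb₀.ne']
    have h1 := mul_le_mul_of_nonneg_left (Real.log_le_sub_one_of_pos
      (show 0 < b * a₀ / (a * b₀) by positivity)) ha.le
    have h2 := mul_le_mul_of_nonneg_left (Real.log_le_sub_one_of_pos
      (show 0 < a * b₀ / (b * a₀) by positivity)) hb.le
    rw [e1] at h1
    rw [e2] at h2
    have e3 : a * (b * a₀ / (a * b₀) - 1) = b * (a₀ / b₀) - a := by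
      field_simp
    have e4 : b * (a * b₀ / (b * a₀) - 1) = a * (b₀ / a₀) - b := by
      field_simp
    rw [e3] at h1
    rw [e4] at h2
    simp only [logGap]
    linarith

variable {c : (Fin d → ℤ) → Move d → ℝ} {mu : (Fin d → ℤ) → ℝ}

/-- The coupling of two chains at neighbouring cells `n` and `m = γ n`, written as an
inequality. For a move `γ'` in another direction both chains perform `γ'` as far as their rates
allow; the excess rate of one chain is used while that chain moves away by `γ'` and the other one
jumps onto its former position. Both chains perform `γ` at the rate of the second and the inverse
move at the rate of the first. What remains are jumps onto each other. In all cases the chains end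
in the same cell or in neighbouring cells. -/
theorem eulerStep_edge_le (hc : IsGridRates N c mu) {τ : ℝ} (hτ : 0 ≤ τ)
    (hτc : ∀ n ∈ grid d N, τ * ∑ γ, c n γ ≤ 1 / 2) {S : Set ℝ} {G : ℝ → ℝ → ℝ}
    (hG : HasAffineSupport S G) (hdiag : ∀ a, G a a = 0) {g : (Fin d → ℤ) → ℝ}
    (hg : ∀ n, g n ∈ S) (hstep : ∀ n ∈ grid d N, eulerStep c τ g n ∈ S)
    {n : Fin d → ℤ} (hn : n ∈ grid d N) {γ : Move d} {m : Fin d → ℤ} (hm : m = move γ n)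
    (hmem : m ∈ grid d N)
    (h1 : 0 ≤ coalescenceRate c n γ) (h2 : 0 ≤ coalescenceRate c m (invMove γ)) :
    G (eulerStep c τ g n) (eulerStep c τ g m) ≤ G (g n) (g m) + τ *
      (∑ γ' : Move d with γ'.1 ≠ γ.1,
        (min (c n γ') (c m γ') * (G (g (move γ' n)) (g (move γ' m)) - G (g n) (g m)) +
          max (c m γ' - c n γ') 0 * (G (g m) (g (move γ' m)) - G (g n) (g m)) +
          max (c n γ' - c m γ') 0 * (G (g (move γ' n)) (g n) - G (g n) (g m))) +
        c m γ * (G (g m) (g (move γ m)) - G (g n) (g m)) +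
        c n (invMove γ) * (G (g (move (invMove γ) n)) (g n) - G (g n) (g m)) -
        (coalescenceRate c n γ + coalescenceRate c m (invMove γ)) * G (g n) (g m)) := by
  -- replace `G` by the affine function that supports it at the point reached after the step:
  -- for affine functions the claimed inequality is an identity up to the coalescence terms
  obtain ⟨α, β, δ, htight, hle⟩ := hG _ (hstep n hn) _ (hstep m hmem)
  have hnm : move (invMove γ) m = n := by rw [hm, move_invMove_move]
  have hmin : ∀ a b : ℝ, min a b + max (a - b) 0 = a := fun a b => by
    rcases le_total a b with h | h
    · rw [min_eq_left h, max_eq_right (sub_nonpos.2 h), add_zero]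
    · rw [min_eq_right h, max_eq_left (sub_nonneg.2 h), add_sub_cancel]
  have hmin' : ∀ a b : ℝ, min a b + max (b - a) 0 = b := fun a b => by
    rw [min_comm, hmin]
  have hk1 : coalescenceRate c n γ =
      c n γ - c m γ - ∑ γ' : Move d with γ'.1 ≠ γ.1, max (c m γ' - c n γ') 0 := by
    rw [coalescenceRate, ← hm]
  have hk2 : coalescenceRate c m (invMove γ) = c m (invMove γ) - c n (invMove γ) -
      ∑ γ' : Move d with γ'.1 ≠ γ.1, max (c n γ' - c m γ') 0 := by
    rw [coalescenceRate, hnm, invMove_fst]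
  -- the total jump rate `R` of the coupled pair is at most `1 / τ`
  set R : ℝ := ∑ γ' : Move d with γ'.1 ≠ γ.1, (min (c n γ') (c m γ') +
      max (c m γ' - c n γ') 0 + max (c n γ' - c m γ') 0) + c m γ + c n (invMove γ) +
      coalescenceRate c n γ + coalescenceRate c m (invMove γ) with hR
  have hRle : τ * R ≤ 1 := by
    have e : R = ∑ γ' : Move d with γ'.1 ≠ γ.1, min (c n γ') (c m γ') +
        c n γ + c m (invMove γ) := by
      rw [hR, hk1, hk2, Finset.sum_add_distrib, Finset.sum_add_distrib]
      ring
    have l1 : ∑ γ' : Move d with γ'.1 ≠ γ.1, min (c n γ') (c m γ') ≤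
        ∑ γ' : Move d with γ'.1 ≠ γ.1, c n γ' :=
      Finset.sum_le_sum fun γ' _ => min_le_left _ _
    have l2 := sum_move_eq γ (c n)
    have l3 : c m (invMove γ) ≤ ∑ γ', c m γ' :=
      Finset.single_le_sum (fun γ' _ => hc.nonneg m γ') (Finset.mem_univ _)
    have l4 := hc.nonneg n (invMove γ)
    have l5 : R ≤ ∑ γ', c n γ' + ∑ γ', c m γ' := by linarith
    have l6 := mul_le_mul_of_nonneg_left l5 hτ
    have l7 := hτc n hn
    have l8 := hτc m hmem
    linarith
  set e : ℝ := α * g n + β * g m + δ with he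
  have hlin : α * eulerStep c τ g n + β * eulerStep c τ g m + δ = (1 - τ * R) * e + τ *
      (∑ γ' : Move d with γ'.1 ≠ γ.1,
        (min (c n γ') (c m γ') * (α * g (move γ' n) + β * g (move γ' m) + δ) +
          max (c m γ' - c n γ') 0 * (α * g m + β * g (move γ' m) + δ) +
          max (c n γ' - c m γ') 0 * (α * g (move γ' n) + β * g n + δ)) +
        c m γ * (α * g m + β * g (move γ m) + δ) +
        c n (invMove γ) * (α * g (move (invMove γ) n) + β * g n + δ) +
        coalescenceRate c n γ * (α * g m + β * g m + δ) +
        coalescenceRate c m (invMove γ) * (α * g n + β * g n + δ)) := by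
    have hsum : ∑ γ' : Move d with γ'.1 ≠ γ.1,
        (min (c n γ') (c m γ') * (α * g (move γ' n) + β * g (move γ' m) + δ) +
          max (c m γ' - c n γ') 0 * (α * g m + β * g (move γ' m) + δ) +
          max (c n γ' - c m γ') 0 * (α * g (move γ' n) + β * g n + δ)) =
        e * ∑ γ' : Move d with γ'.1 ≠ γ.1, (min (c n γ') (c m γ') +
          max (c m γ' - c n γ') 0 + max (c n γ' - c m γ') 0) +
        (α * ∑ γ' : Move d with γ'.1 ≠ γ.1, c n γ' * (g (move γ' n) - g n) +
          β * ∑ γ' : Move d with γ'.1 ≠ γ.1, c m γ' * (g (move γ' m) - g m) +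
          α * (g m - g n) * ∑ γ' : Move d with γ'.1 ≠ γ.1, max (c m γ' - c n γ') 0 +
          β * (g n - g m) * ∑ γ' : Move d with γ'.1 ≠ γ.1, max (c n γ' - c m γ') 0) := by
      simp only [Finset.mul_sum, ← Finset.sum_add_distrib]
      refine Finset.sum_congr rfl fun γ' _ => ?_
      have i1 := hmin (c n γ') (c m γ')
      have i2 := hmin' (c n γ') (c m γ')
      rw [he]
      linear_combination (α * (g (move γ' n) - g n)) * i1 + (β * (g (move γ' m) - g m)) * i2
    have s1 := sum_move_eq γ fun γ' => c n γ' * (g (move γ' n) - g n)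
    have s2 := sum_move_eq γ fun γ' => c m γ' * (g (move γ' m) - g m)
    simp only [← hm, hnm] at s1 s2
    rw [hsum, eulerStep, eulerStep, s1, s2, hR, he]
    linear_combination (-(τ * α * (g m - g n))) * hk1 + (-(τ * β * (g n - g m))) * hk2
  rw [htight, hlin]
  have b0 : (1 - τ * R) * e ≤ (1 - τ * R) * G (g n) (g m) :=
    mul_le_mul_of_nonneg_left (hle _ (hg n) _ (hg m)) (by linarith)
  have b1 : ∑ γ' : Move d with γ'.1 ≠ γ.1,
        (min (c n γ') (c m γ') * (α * g (move γ' n) + β * g (move γ' m) + δ) +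
          max (c m γ' - c n γ') 0 * (α * g m + β * g (move γ' m) + δ) +
          max (c n γ' - c m γ') 0 * (α * g (move γ' n) + β * g n + δ)) ≤
      ∑ γ' : Move d with γ'.1 ≠ γ.1,
        (min (c n γ') (c m γ') * G (g (move γ' n)) (g (move γ' m)) +
          max (c m γ' - c n γ') 0 * G (g m) (g (move γ' m)) +
          max (c n γ' - c m γ') 0 * G (g (move γ' n)) (g n)) :=
    Finset.sum_le_sum fun γ' _ => add_le_add (add_le_add
      (mul_le_mul_of_nonneg_left (hle _ (hg _) _ (hg _))
        (le_min (hc.nonneg _ _) (hc.nonneg _ _)))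
      (mul_le_mul_of_nonneg_left (hle _ (hg _) _ (hg _)) (le_max_right _ _)))
      (mul_le_mul_of_nonneg_left (hle _ (hg _) _ (hg _)) (le_max_right _ _))
  have b2 := mul_le_mul_of_nonneg_left (hle _ (hg m) _ (hg (move γ m))) (hc.nonneg m γ)
  have b3 := mul_le_mul_of_nonneg_left (hle _ (hg (move (invMove γ) n)) _ (hg n))
    (hc.nonneg n (invMove γ))
  have b4 := mul_le_mul_of_nonneg_left (hle _ (hg m) _ (hg m)) h1
  have b5 := mul_le_mul_of_nonneg_left (hle _ (hg n) _ (hg n)) h2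
  rw [hdiag, mul_zero] at b4 b5
  have b6 := mul_le_mul_of_nonneg_left
    (add_le_add (add_le_add (add_le_add (add_le_add b1 b2) b3) b4) b5) hτ
  refine (add_le_add b0 b6).trans (le_of_eq ?_)
  have hsplit : ∑ γ' : Move d with γ'.1 ≠ γ.1,
        (min (c n γ') (c m γ') * (G (g (move γ' n)) (g (move γ' m)) - G (g n) (g m)) +
          max (c m γ' - c n γ') 0 * (G (g m) (g (move γ' m)) - G (g n) (g m)) +
          max (c n γ' - c m γ') 0 * (G (g (move γ' n)) (g n) - G (g n) (g m))) =
      ∑ γ' : Move d with γ'.1 ≠ γ.1,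
        (min (c n γ') (c m γ') * G (g (move γ' n)) (g (move γ' m)) +
          max (c m γ' - c n γ') 0 * G (g m) (g (move γ' m)) +
          max (c n γ' - c m γ') 0 * G (g (move γ' n)) (g n)) -
      G (g n) (g m) * ∑ γ' : Move d with γ'.1 ≠ γ.1, (min (c n γ') (c m γ') +
          max (c m γ' - c n γ') 0 + max (c n γ' - c m γ') 0) := by
    rw [Finset.mul_sum, ← Finset.sum_sub_distrib]
    exact Finset.sum_congr rfl fun γ' _ => by ring
  rw [hsplit, hR]
  ring

/-- The joint moves in a direction other than that of the edge are reversible with respect to the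
edge weights `mu(n) c(n, γ)`. -/
theorem IsGridRates.joint_moves (hc : IsGridRates N c mu) (G : ℝ → ℝ → ℝ)
    (g : (Fin d → ℤ) → ℝ) :
    crossSum (fun γ γ' => ∑ n ∈ grid d N, mu n * c n γ * (min (c n γ') (c (move γ n) γ') *
      G (g (move γ' n)) (g (move γ' (move γ n))))) =
    crossSum (fun γ γ' => ∑ n ∈ grid d N, mu n * c n γ * (min (c n γ') (c (move γ n) γ') *
      G (g n) (g (move γ n)))) := by
  rw [← crossSum_inv_right (fun γ γ' => ∑ n ∈ grid d N,
    mu n * c n γ * (min (c n γ') (c (move γ n) γ') * G (g n) (g (move γ n))))]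
  refine crossSum_congr fun γ γ' hne => sum_grid_move γ' ?_ ?_ ?_
  · intro n hn hmem
    have hb := hc.balance n hn γ' hmem
    have x1 := hc.exchange n hn γ γ' hne
    have x2 := hc.exchange (move γ' n) hmem γ (invMove γ') hne
    rw [move_invMove_move] at x2
    have hn1 : 0 ≤ mu n * c n γ := mul_nonneg (hc.mu_nonneg _) (hc.nonneg _ _)
    have hn2 : 0 ≤ mu (move γ' n) * c (move γ' n) γ := mul_nonneg (hc.mu_nonneg _) (hc.nonneg _ _)
    have key : mu n * c n γ * min (c n γ') (c (move γ n) γ') =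
        mu (move γ' n) * c (move γ' n) γ *
          min (c (move γ' n) (invMove γ')) (c (move γ (move γ' n)) (invMove γ')) := by
      rw [mul_min_of_nonneg _ _ hn1, mul_min_of_nonneg _ _ hn2, min_comm]
      congr 1
      · linear_combination mu n * x1 + c (move γ' n) γ * hb
      · linear_combination c n γ * hb - mu (move γ' n) * x2
    rw [← mul_assoc, key, move_comm γ' γ, mul_assoc]
  · intro n _ hmem
    rw [hc.eq_zero n γ' hmem, min_eq_left (hc.nonneg _ _)]
    ring
  · intro n _ hmem
    rw [hc.eq_zero n _ hmem, min_eq_left (hc.nonneg _ _)]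
    ring

/-- The moves in which the first chain uses its excess rate for `γ'` lead from the edge in direction
`γ` to the edge in direction `γ'` at the same cell. The weight
`mu(n) c(n, γ) (c(n, γ') - c(γ n, γ'))⁺` of this transition is symmetric in `γ` and `γ'`. -/
theorem IsGridRates.first_excess (hc : IsGridRates N c mu) {G : ℝ → ℝ → ℝ}
    (hsymm : ∀ a b, G a b = G b a) (g : (Fin d → ℤ) → ℝ) :
    crossSum (fun γ γ' => ∑ n ∈ grid d N, mu n * c n γ * (max (c n γ' - c (move γ n) γ') 0 *
      G (g (move γ' n)) (g n))) =
    crossSum (fun γ γ' => ∑ n ∈ grid d N, mu n * c n γ * (max (c n γ' - c (move γ n) γ') 0 *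
      G (g n) (g (move γ n)))) := by
  rw [← crossSum_swap (fun γ γ' => ∑ n ∈ grid d N,
    mu n * c n γ * (max (c n γ' - c (move γ n) γ') 0 * G (g n) (g (move γ n))))]
  refine crossSum_congr fun γ γ' hne => Finset.sum_congr rfl fun n hn => ?_
  have key : c n γ * max (c n γ' - c (move γ n) γ') 0 =
      c n γ' * max (c n γ - c (move γ' n) γ) 0 := by
    rw [mul_max_of_nonneg _ _ (hc.nonneg _ _), mul_max_of_nonneg _ _ (hc.nonneg _ _)]
    congr 1
    · linear_combination -hc.exchange n hn γ γ' hne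
    · ring
  rw [hsymm (g (move γ' n))]
  linear_combination mu n * G (g n) (g (move γ' n)) * key

/-- The counterpart of `IsGridRates.first_excess` for the excess rate of the second chain. -/
theorem IsGridRates.second_excess (hc : IsGridRates N c mu) {G : ℝ → ℝ → ℝ}
    (hsymm : ∀ a b, G a b = G b a) (g : (Fin d → ℤ) → ℝ) :
    crossSum (fun γ γ' => ∑ n ∈ grid d N, mu n * c n γ * (max (c (move γ n) γ' - c n γ') 0 *
      G (g (move γ n)) (g (move γ' (move γ n))))) =
    crossSum (fun γ γ' => ∑ n ∈ grid d N, mu n * c n γ * (max (c (move γ n) γ' - c n γ') 0 *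
      G (g n) (g (move γ n)))) := by
  -- reversing the orientation of the edge `(n, γ n)` exchanges the roles of the two chains
  have hflip : ∀ γ γ' : Move d, ∀ H : (Fin d → ℤ) → (Fin d → ℤ) → ℝ,
      ∑ n ∈ grid d N, mu n * c n γ * (max (c (move γ n) γ' - c n γ') 0 * H n (move γ n)) =
      ∑ n ∈ grid d N, mu n * c n (invMove γ) * (max (c n γ' - c (move (invMove γ) n) γ') 0 *
        H (move (invMove γ) n) n) := by
    intro γ γ' H
    refine sum_grid_move γ ?_ ?_ ?_
    · intro n hn hmem
      rw [hc.balance n hn γ hmem, move_invMove_move]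
    · intro n _ hmem
      rw [hc.eq_zero n γ hmem]
      ring
    · intro n _ hmem
      rw [hc.eq_zero n _ hmem]
      ring
  have h1 := crossSum_congr fun γ γ' (_ : γ.1 ≠ γ'.1) =>
    hflip γ γ' fun _ m => G (g m) (g (move γ' m))
  have h2 := crossSum_congr fun γ γ' (_ : γ.1 ≠ γ'.1) => hflip γ γ' fun n m => G (g n) (g m)
  rw [h1, h2, crossSum_inv_left (fun γ γ' => ∑ n ∈ grid d N, mu n * c n γ *
      (max (c n γ' - c (move γ n) γ') 0 * G (g n) (g (move γ' n)))),
    crossSum_inv_left (fun γ γ' => ∑ n ∈ grid d N, mu n * c n γ *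
      (max (c n γ' - c (move γ n) γ') 0 * G (g (move γ n)) (g n)))]
  simp only [fun a : Fin d → ℤ => fun γ : Move d => hsymm (g (move γ a)) (g a)]
  rw [← hc.first_excess hsymm]
  simp only [fun a : Fin d → ℤ => fun γ : Move d => hsymm (g (move γ a)) (g a)]

/-- Joint moves along the edge, from `(n, γ n)` to `(γ n, γ γ n)`. Reversing such a transition
turns it into a joint move by the inverse of `γ`, so that the sum over the targets is the sum
over the starting edges of the backward moves. -/
theorem IsGridRates.forward_moves (hc : IsGridRates N c mu) (G : ℝ → ℝ → ℝ)
    (g : (Fin d → ℤ) → ℝ) (γ : Move d) :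
    ∑ n ∈ grid d N, mu n * c n γ * (c (move γ n) γ *
      G (g (move γ n)) (g (move γ (move γ n)))) =
    ∑ n ∈ grid d N, mu n * c n γ * (c n (invMove γ) * G (g n) (g (move γ n))) := by
  refine sum_grid_move γ ?_ ?_ ?_
  · intro n hn hmem
    rw [hc.balance n hn γ hmem]
    ring
  · intro n _ hmem
    rw [hc.eq_zero n γ hmem]
    ring
  · intro n _ hmem
    rw [hc.eq_zero n _ hmem]
    ring

/-- The reversal of `IsGridRates.forward_moves`. -/
theorem IsGridRates.backward_moves (hc : IsGridRates N c mu) (G : ℝ → ℝ → ℝ)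
    (g : (Fin d → ℤ) → ℝ) (γ : Move d) :
    ∑ n ∈ grid d N, mu n * c n γ * (c n (invMove γ) * G (g (move (invMove γ) n)) (g n)) =
    ∑ n ∈ grid d N, mu n * c n γ * (c (move γ n) γ * G (g n) (g (move γ n))) := by
  refine sum_grid_move (invMove γ) ?_ ?_ ?_
  · intro n hn hmem
    have hb := hc.balance n hn (invMove γ) hmem
    rw [invMove_invMove] at hb
    rw [move_move_invMove]
    linear_combination c n γ * G (g (move (invMove γ) n)) (g n) * hb
  · intro n _ hmem
    rw [hc.eq_zero n _ hmem]
    ring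
  · intro n _ hmem
    rw [invMove_invMove] at hmem
    rw [hc.eq_zero n _ hmem]
    ring

/-- One Euler step contracts every edge functional of a jointly convex symmetric function that
vanishes on the diagonal: the coupling is reversible with respect to the edge weights, and
it loses mass at a rate at least `κ`. -/
theorem gridEdgeSum_eulerStep_le (hc : IsGridRates N c mu) {τ : ℝ} (hτ : 0 ≤ τ)
    (hτc : ∀ n ∈ grid d N, τ * ∑ γ, c n γ ≤ 1 / 2) {S : Set ℝ} {G : ℝ → ℝ → ℝ}
    (hG : HasAffineSupport S G) (hdiag : ∀ a, G a a = 0) (hsymm : ∀ a b, G a b = G b a)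
    (hG0 : ∀ a ∈ S, ∀ b ∈ S, 0 ≤ G a b) {g : (Fin d → ℤ) → ℝ}
    (hg : ∀ n, g n ∈ S) (hstep : ∀ n ∈ grid d N, eulerStep c τ g n ∈ S)
    (hcoal : ∀ n ∈ grid d N, ∀ γ, move γ n ∈ grid d N → 0 ≤ coalescenceRate c n γ) {κ : ℝ}
    (hκ : ∀ n ∈ grid d N, ∀ γ, move γ n ∈ grid d N →
      κ ≤ coalescenceRate c n γ + coalescenceRate c (move γ n) (invMove γ)) :
    gridEdgeSum N c mu G (eulerStep c τ g) ≤ (1 - κ * τ) * gridEdgeSum N c mu G g := by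
  have hedge : ∀ n ∈ grid d N, ∀ γ : Move d,
      mu n * c n γ * G (eulerStep c τ g n) (eulerStep c τ g (move γ n)) ≤
      (1 - κ * τ) * (mu n * c n γ * G (g n) (g (move γ n))) + τ *
      ((∑ γ' : Move d with γ'.1 ≠ γ.1, mu n * c n γ * (min (c n γ') (c (move γ n) γ') *
          G (g (move γ' n)) (g (move γ' (move γ n)))) -
        ∑ γ' : Move d with γ'.1 ≠ γ.1, mu n * c n γ * (min (c n γ') (c (move γ n) γ') *
          G (g n) (g (move γ n)))) +
       (∑ γ' : Move d with γ'.1 ≠ γ.1, mu n * c n γ * (max (c (move γ n) γ' - c n γ') 0 *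
          G (g (move γ n)) (g (move γ' (move γ n)))) -
        ∑ γ' : Move d with γ'.1 ≠ γ.1, mu n * c n γ * (max (c (move γ n) γ' - c n γ') 0 *
          G (g n) (g (move γ n)))) +
       (∑ γ' : Move d with γ'.1 ≠ γ.1, mu n * c n γ * (max (c n γ' - c (move γ n) γ') 0 *
          G (g (move γ' n)) (g n)) -
        ∑ γ' : Move d with γ'.1 ≠ γ.1, mu n * c n γ * (max (c n γ' - c (move γ n) γ') 0 *
          G (g n) (g (move γ n)))) +
       (mu n * c n γ * (c (move γ n) γ * G (g (move γ n)) (g (move γ (move γ n)))) -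
        mu n * c n γ * (c n (invMove γ) * G (g n) (g (move γ n)))) +
       (mu n * c n γ * (c n (invMove γ) * G (g (move (invMove γ) n)) (g n)) -
        mu n * c n γ * (c (move γ n) γ * G (g n) (g (move γ n))))) := by
    intro n hn γ
    by_cases hmem : move γ n ∈ grid d N
    · have hback : move (invMove γ) (move γ n) ∈ grid d N := by rwa [move_invMove_move]
      have h := eulerStep_edge_le hc hτ hτc hG hdiag hg hstep hn rfl hmem (hcoal n hn γ hmem)
        (hcoal _ hmem _ hback)
      have hw : 0 ≤ mu n * c n γ := mul_nonneg (hc.mu_nonneg _) (hc.nonneg _ _)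
      have h' := mul_le_mul_of_nonneg_left h hw
      have hκ' := mul_le_mul_of_nonneg_left (mul_le_mul_of_nonneg_right (hκ n hn γ hmem)
        (hG0 _ (hg n) _ (hg (move γ n)))) (mul_nonneg hw hτ)
      simp only [mul_sub, Finset.sum_add_distrib, Finset.sum_sub_distrib] at h'
      simp only [← Finset.mul_sum]
      linarith
    · simp [hc.eq_zero n γ hmem]
  refine (Finset.sum_le_sum fun n hn => Finset.sum_le_sum fun γ _ => hedge n hn γ).trans
    (le_of_eq ?_)
  have hcross : ∀ F : (Fin d → ℤ) → Move d → Move d → ℝ,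
      ∑ n ∈ grid d N, ∑ γ, ∑ γ' : Move d with γ'.1 ≠ γ.1, F n γ γ' =
      crossSum fun γ γ' => ∑ n ∈ grid d N, F n γ γ' := by
    intro F
    rw [Finset.sum_comm]
    exact Finset.sum_congr rfl fun γ _ => Finset.sum_comm
  have hA := hc.joint_moves G g
  have hB := hc.second_excess hsymm g
  have hC := hc.first_excess hsymm g
  have hD := Finset.sum_congr (rfl : (Finset.univ : Finset (Move d)) = Finset.univ)
    fun γ _ => hc.forward_moves G g γ
  have hE := Finset.sum_congr (rfl : (Finset.univ : Finset (Move d)) = Finset.univ)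
    fun γ _ => hc.backward_moves G g γ
  rw [← hcross, ← hcross] at hA hB hC
  rw [Finset.sum_comm, Finset.sum_comm (s := Finset.univ)] at hD hE
  simp only [Finset.sum_add_distrib, Finset.sum_sub_distrib, ← Finset.mul_sum, gridEdgeSum]
    at hA hB hC hD hE ⊢
  rw [hA, hB, hC, hD, hE]
  ring

end Grid

/-! ### The transition matrix of the scheme -/

section Scheme

variable {d N : ℕ} {K h σ : ℝ} {V : EuclideanSpace ℝ (Fin d) → ℝ}

/-- The extension of a function on the cells by `1` to all multi-indices. The value `1` keeps
positive functions positive. -/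
noncomputable def extendOne (f : Cell d N → ℝ) (n : Fin d → ℤ) : ℝ :=
  if hn : n ∈ grid d N then f ⟨n, hn⟩ else 1

theorem extendOne_of_mem (f : Cell d N → ℝ) {n : Fin d → ℤ} (hn : n ∈ grid d N) :
    extendOne f n = f ⟨n, hn⟩ := dif_pos hn

theorem extendOne_coe (f : Cell d N → ℝ) (i : Cell d N) : extendOne f i.1 = f i :=
  extendOne_of_mem f i.2

theorem rate_of_notMem {n : Fin d → ℤ} {γ : Move d} (hn : move γ n ∉ grid d N) :
    rate N K h σ V n γ = 0 := if_neg hn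

theorem rate_of_mem {n : Fin d → ℤ} {γ : Move d} (hn : move γ n ∈ grid d N) :
    rate N K h σ V n γ =
      σ ^ 2 / h ^ 2 * Real.exp (-(meanV K h V (move γ n) - meanV K h V n) / (2 * σ ^ 2)) :=
  if_pos hn

theorem rate_nonneg (n : Fin d → ℤ) (γ : Move d) : 0 ≤ rate N K h σ V n γ := by
  unfold rate
  split_ifs <;> positivity

theorem rate_pos (hh : 0 < h) (hσ : 0 < σ) {n : Fin d → ℤ} {γ : Move d}
    (hn : move γ n ∈ grid d N) : 0 < rate N K h σ V n γ := by
  rw [rate_of_mem hn]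
  positivity

theorem isGridRates_rate (hσ : 0 < σ) :
    IsGridRates N (rate N K h σ V) (fun n => Real.exp (-meanV K h V n / σ ^ 2)) where
  nonneg := rate_nonneg
  mu_nonneg n := (Real.exp_pos _).le
  eq_zero n γ hn := rate_of_notMem hn
  balance n hn γ hmem := by
    have hback : move (invMove γ) (move γ n) ∈ grid d N := by rwa [move_invMove_move]
    rw [rate_of_mem hmem, rate_of_mem hback, move_invMove_move, mul_left_comm, ← Real.exp_add,
      mul_left_comm, ← Real.exp_add]
    congr 2
    field_simp
    ring
  exchange n hn γ γ' hne := by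
    by_cases hmem : move γ n ∈ grid d N ∧ move γ' n ∈ grid d N
    · have h1 := (move_move_mem_grid_iff hn hne).2 hmem
      have h2 : move γ (move γ' n) ∈ grid d N := by rwa [move_comm]
      rw [rate_of_mem hmem.1, rate_of_mem hmem.2, rate_of_mem h1, rate_of_mem h2,
        mul_mul_mul_comm, ← Real.exp_add, mul_mul_mul_comm (σ ^ 2 / h ^ 2) _ (σ ^ 2 / h ^ 2),
        ← Real.exp_add, move_comm γ' γ]
      congr 2
      ring
    · have h1 : move γ' (move γ n) ∉ grid d N := fun h => hmem ((move_move_mem_grid_iff hn hne).1 h)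
      have h2 : move γ (move γ' n) ∉ grid d N := by rwa [move_comm]
      rw [rate_of_notMem h1, rate_of_notMem h2, mul_zero, mul_zero]

theorem timeStep_mul_sum_rate_le {n : Fin d → ℤ} (hn : n ∈ grid d N) :
    timeStep N K h σ V * ∑ γ, rate N K h σ V n γ ≤ 1 / 2 := by
  have hle : ∑ γ, rate N K h σ V n γ ≤ ⨆ i : Cell d N, ∑ γ : Move d, rate N K h σ V i.1 γ :=
    le_ciSup (f := fun i : Cell d N => ∑ γ : Move d, rate N K h σ V i.1 γ)
      (Set.finite_range _).bddAbove ⟨n, hn⟩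
  have h0 : 0 ≤ ∑ γ, rate N K h σ V n γ := Finset.sum_nonneg fun γ _ => rate_nonneg n γ
  have hT : ∑ γ, rate N K h σ V n γ ≤ totalRate N K h σ V / 2 := by
    rw [totalRate]
    linarith
  have hT0 : 0 ≤ totalRate N K h σ V := by linarith
  have h1 := mul_le_mul_of_nonneg_left hT (inv_nonneg.2 hT0)
  refine h1.trans ?_
  have h2 := inv_mul_le_one (a := totalRate N K h σ V)
  linarith

theorem totalRate_pos (hd : 1 ≤ d) (hN : 2 ≤ N) (hh : 0 < h) (hσ : 0 < σ) :
    0 < totalRate N K h σ V := by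
  let γ : Move d := (⟨0, hd⟩, 1)
  have hmem : (fun _ => 1 : Fin d → ℤ) ∈ grid d N := by
    simp only [grid, Fintype.mem_piFinset, Finset.mem_Icc]
    omega
  have hmem' : move γ (fun _ => 1 : Fin d → ℤ) ∈ grid d N := by
    simp only [grid, Fintype.mem_piFinset, Finset.mem_Icc, move, Pi.add_apply, γ, Units.val_one]
    intro k
    rcases eq_or_ne k ⟨0, hd⟩ with rfl | hk
    · rw [Pi.single_eq_same]
      omega
    · rw [Pi.single_eq_of_ne hk]
      omega
  have h1 : 0 < ∑ γ, rate N K h σ V (fun _ => 1) γ :=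
    Finset.sum_pos' (fun γ _ => rate_nonneg _ γ) ⟨γ, Finset.mem_univ _, rate_pos hh hσ hmem'⟩
  have hle : ∑ γ, rate N K h σ V (fun _ => 1) γ ≤
      ⨆ i : Cell d N, ∑ γ : Move d, rate N K h σ V i.1 γ :=
    le_ciSup (f := fun i : Cell d N => ∑ γ : Move d, rate N K h σ V i.1 γ)
      (Set.finite_range _).bddAbove ⟨_, hmem⟩
  rw [totalRate]
  linarith

/-- The action of the transition matrix, as a sum over moves. -/
theorem sum_transition_mul (u : Cell d N → ℝ) (i : Cell d N) :
    ∑ k, transition N K h σ V i k * u k =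
      eulerStep (rate N K h σ V) (timeStep N K h σ V) (extendOne u) i.1 := by
  have hsplit : ∀ k, transition N K h σ V i k * u k =
      (if k = i then (1 - ∑ γ, rate N K h σ V i.1 γ / totalRate N K h σ V) * u i else 0) +
      ∑ γ, if k.1 = move γ i.1 then rate N K h σ V i.1 γ / totalRate N K h σ V * u k else 0 := by
    intro k
    by_cases hk : k = i
    · subst hk
      simp [transition, (move_ne _ _).symm]
    · simp [transition, hk, Finset.sum_mul, ite_mul]
  have hmove : ∀ γ, (∑ k : Cell d N, if k.1 = move γ i.1 then
      rate N K h σ V i.1 γ / totalRate N K h σ V * u k else 0) =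
      rate N K h σ V i.1 γ / totalRate N K h σ V * extendOne u (move γ i.1) := by
    intro γ
    by_cases hmem : move γ i.1 ∈ grid d N
    · rw [extendOne_of_mem u hmem, Finset.sum_eq_single ⟨_, hmem⟩]
      · simp
      · intro k _ hk
        exact if_neg fun h => hk (Subtype.ext h)
      · simp
    · simp [rate_of_notMem hmem]
  rw [Finset.sum_congr rfl fun k _ => hsplit k, Finset.sum_add_distrib, Finset.sum_comm,
    Finset.sum_congr rfl fun γ _ => hmove γ]
  have e : (totalRate N K h σ V)⁻¹ *
      ∑ γ, rate N K h σ V i.1 γ * (extendOne u (move γ i.1) - u i) =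
      ∑ γ, rate N K h σ V i.1 γ / totalRate N K h σ V * extendOne u (move γ i.1) -
        (∑ γ, rate N K h σ V i.1 γ / totalRate N K h σ V) * u i := by
    rw [Finset.mul_sum, Finset.sum_mul, ← Finset.sum_sub_distrib]
    exact Finset.sum_congr rfl fun γ _ => by ring
  rw [eulerStep, timeStep, extendOne_coe, e, Finset.sum_ite_eq', if_pos (Finset.mem_univ i)]
  ring

theorem transition_mulVec (f : Cell d N → ℝ) (i : Cell d N) :
    (transition N K h σ V *ᵥ f) i =
      eulerStep (rate N K h σ V) (timeStep N K h σ V) (extendOne f) i.1 :=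
  sum_transition_mul f i

theorem totalRate_nonneg : 0 ≤ totalRate N K h σ V :=
  mul_nonneg zero_le_two (Real.iSup_nonneg fun i => Finset.sum_nonneg fun γ _ => rate_nonneg i.1 γ)

theorem transition_nonneg (i k : Cell d N) : 0 ≤ transition N K h σ V i k := by
  unfold transition
  split_ifs with hik
  · have hle := timeStep_mul_sum_rate_le (K := K) (h := h) (σ := σ) (V := V) i.2
    rw [← Finset.sum_div, div_eq_inv_mul]
    rw [timeStep] at hle
    linarith
  · refine Finset.sum_nonneg fun γ _ => ?_
    split_ifs
    · exact div_nonneg (rate_nonneg _ _) totalRate_nonneg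
    · exact le_rfl

theorem transition_move_pos (hh : 0 < h) (hσ : 0 < σ) (hT : 0 < totalRate N K h σ V)
    {i k : Cell d N} {γ : Move d} (hk : k.1 = move γ i.1) : 0 < transition N K h σ V i k := by
  have hne : k ≠ i := fun e => move_ne γ i.1 (by rw [← hk, e])
  rw [transition, if_neg hne]
  have hmem : move γ i.1 ∈ grid d N := hk ▸ k.2
  refine Finset.sum_pos' (fun γ _ => ?_) ⟨γ, Finset.mem_univ _, ?_⟩
  · split_ifs
    · exact div_nonneg (rate_nonneg _ _) hT.le
    · exact le_rfl
  · rw [if_pos hk]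
    exact div_pos (rate_pos hh hσ hmem) hT

theorem isReversibleChain_transition [Nonempty (Cell d N)] (hσ : 0 < σ) :
    IsReversibleChain (transition N K h σ V) (invMeasure N K h σ V) where
  nonneg := transition_nonneg
  row_sum i := by
    have hs := sum_transition_mul (K := K) (h := h) (σ := σ) (V := V) (fun _ => 1) i
    simp only [mul_one] at hs
    rw [hs]
    simp [eulerStep, extendOne]
  pos i := mul_pos (inv_pos.2 (Finset.sum_pos (fun _ _ => Real.exp_pos _) Finset.univ_nonempty))
    (Real.exp_pos _)
  sum_eq_one := by
    simp only [invMeasure, ← Finset.mul_sum]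
    exact inv_mul_cancel₀
      (Finset.sum_pos (fun _ _ => Real.exp_pos _) Finset.univ_nonempty).ne'
  balance i k := by
    by_cases hik : k = i
    · rw [hik]
    · rw [transition, transition, if_neg hik, if_neg (Ne.symm hik), Finset.mul_sum,
        Finset.mul_sum]
      refine Fintype.sum_equiv (invMove_involutive (d := d)).toPerm _ _ fun γ => ?_
      rw [Function.Involutive.coe_toPerm]
      by_cases hk : k.1 = move γ i.1
      · have hi : i.1 = move (invMove γ) k.1 := by rw [hk, move_invMove_move]
        have hb := (isGridRates_rate (N := N) (K := K) (h := h) (V := V) hσ).balance i.1 i.2 γ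
          (hk ▸ k.2)
        rw [← hk] at hb
        rw [if_pos hk, if_pos hi, invMeasure, invMeasure]
        linear_combination (∑ k : Cell d N, Real.exp (-meanV K h V k.1 / σ ^ 2))⁻¹ *
          (totalRate N K h σ V)⁻¹ * hb
      · have hi : i.1 ≠ move (invMove γ) k.1 := fun e => hk (by rw [e, move_move_invMove])
        rw [if_neg hk, if_neg hi, mul_zero, mul_zero]

theorem reflTransGen_transition (hh : 0 < h) (hσ : 0 < σ) (hT : 0 < totalRate N K h σ V)
    (i j : Cell d N) :
    Relation.ReflTransGen (fun i j => 0 < transition N K h σ V i j) i j := by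
  have : Nonempty (Cell d N) := ⟨i⟩
  have hmemIff : ∀ n : Fin d → ℤ, n ∈ grid d N ↔ ∀ k, 1 ≤ n k ∧ n k ≤ N := fun n => by
    simp only [grid, Fintype.mem_piFinset, Finset.mem_Icc]
  have hsymm : Std.Symm fun i j : Cell d N => 0 < transition N K h σ V i j := by
    refine ⟨fun a b hab => ?_⟩
    have hP := isReversibleChain_transition (N := N) (K := K) (h := h) (V := V) hσ
    have hb := hP.balance a b
    have h1 := mul_pos (hP.pos a) hab
    rw [hb] at h1
    exact (mul_pos_iff_of_pos_left (hP.pos b)).1 h1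
  have hbot : (fun _ => 1 : Fin d → ℤ) ∈ grid d N := by
    rw [hmemIff]
    intro k
    have := (hmemIff i.1).1 i.2 k
    omega
  -- every cell is connected to the cell `(1, …, 1)`, by induction on the distance to it
  have hconn : ∀ s : ℕ, ∀ a : Cell d N, ∑ k, (a.1 k - 1) = s →
      Relation.ReflTransGen (fun i j => 0 < transition N K h σ V i j) a ⟨_, hbot⟩ := by
    intro s
    induction s with
    | zero =>
      intro a ha
      have hnn : ∀ k ∈ Finset.univ, 0 ≤ a.1 k - 1 := fun k _ => by
        have := (hmemIff a.1).1 a.2 k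
        omega
      have hz := (Finset.sum_eq_zero_iff_of_nonneg hnn).1 (by simpa using ha)
      have e : a = ⟨_, hbot⟩ :=
        Subtype.ext (funext fun k => sub_eq_zero.1 (hz k (Finset.mem_univ k)))
      rw [e]
    | succ s ih =>
      intro a ha
      obtain ⟨k, -, hk⟩ : ∃ k ∈ Finset.univ, 0 < a.1 k - 1 := by
        by_contra! hcon
        have := Finset.sum_nonpos hcon
        omega
      have hmem : move (k, -1) a.1 ∈ grid d N := by
        rw [hmemIff]
        intro l
        have hl := (hmemIff a.1).1 a.2 l
        simp only [move, Pi.add_apply, Units.val_neg, Units.val_one]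
        rcases eq_or_ne l k with rfl | hlk
        · rw [Pi.single_eq_same]
          omega
        · rw [Pi.single_eq_of_ne hlk]
          omega
      refine Relation.ReflTransGen.head (b := ⟨_, hmem⟩)
        (transition_move_pos hh hσ hT (γ := (k, -1)) rfl) (ih _ ?_)
      have e : ∀ l, move (k, -1) a.1 l - 1 = (a.1 l - 1) + Pi.single (M := fun _ => ℤ) k (-1) l :=
        fun l => by
          simp only [move, Pi.add_apply, Units.val_neg, Units.val_one]
          ring
      simp only [e, Finset.sum_add_distrib, ha, Finset.sum_pi_single', Finset.mem_univ, if_true]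
      push_cast
      ring
  have hconn' : ∀ a : Cell d N,
      Relation.ReflTransGen (fun i j => 0 < transition N K h σ V i j) a ⟨_, hbot⟩ := fun a => by
    have h0 : 0 ≤ ∑ k, (a.1 k - 1) := Finset.sum_nonneg fun k _ => by
      have := (hmemIff a.1).1 a.2 k
      omega
    exact hconn _ a (Int.toNat_of_nonneg h0).symm
  exact (hconn' i).trans (Relation.ReflTransGen.stdSymm.symm _ _ (hconn' j))

/-- The edge functional of the chain as a sum over oriented edges of the grid; `g` is any extension
of `f` from the cells to all multi-indices. -/
theorem edgeSum_transition {G : ℝ → ℝ → ℝ} (hdiag : ∀ a, G a a = 0) {f : Cell d N → ℝ}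
    {g : (Fin d → ℤ) → ℝ} (hfg : ∀ i, f i = g i.1) :
    edgeSum (transition N K h σ V) (invMeasure N K h σ V) G f =
      (∑ k : Cell d N, Real.exp (-meanV K h V k.1 / σ ^ 2))⁻¹ * timeStep N K h σ V *
        gridEdgeSum N (rate N K h σ V) (fun n => Real.exp (-meanV K h V n / σ ^ 2)) G g := by
  rw [edgeSum, gridEdgeSum, ← Finset.sum_coe_sort (grid d N), Finset.mul_sum]
  refine Finset.sum_congr rfl fun i _ => ?_
  simp only [mul_assoc, ← Finset.mul_sum]
  rw [sum_transition_mul fun k => G (f i) (f k), eulerStep, extendOne_coe, hdiag, zero_add]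
  have e : ∑ γ, rate N K h σ V i.1 γ * (extendOne (fun k => G (f i) (f k)) (move γ i.1) - 0) =
      ∑ γ, rate N K h σ V i.1 γ * G (g i.1) (g (move γ i.1)) := by
    refine Finset.sum_congr rfl fun γ _ => ?_
    by_cases hmem : move γ i.1 ∈ grid d N
    · rw [extendOne_of_mem _ hmem, hfg, hfg, sub_zero]
    · rw [rate_of_notMem hmem, zero_mul, zero_mul]
  rw [e, invMeasure]
  ring

/-- The definition of `κ₁` uses only the positive orientation of each edge, but the bound is
symmetric in the orientation. The positivity assumption makes the infimum a genuine lower bound. -/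
theorem kappaOne_le (hA3 : AssumptionA3 N K h σ V) {n : Fin d → ℤ} (hn : n ∈ grid d N)
    {γ : Move d} (hmem : move γ n ∈ grid d N) :
    kappaOne N K h σ V ≤
      kappaMove N K h σ V n γ + kappaMove N K h σ V (move γ n) (invMove γ) := by
  have hbdd : BddBelow {r | ∃ (n : Fin d → ℤ) (j : Fin d), n ∈ grid d N ∧
      move (j, 1) n ∈ grid d N ∧
      r = kappaMove N K h σ V n (j, 1) + kappaMove N K h σ V (move (j, 1) n) (j, -1)} := by
    refine ⟨0, ?_⟩
    rintro r ⟨n, j, hn, hmem, rfl⟩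
    have hback : move (invMove (j, 1)) (move (j, 1) n) ∈ grid d N := by
      rwa [move_invMove_move]
    exact (add_pos (hA3 n hn _ hmem) (hA3 _ hmem _ hback)).le
  obtain ⟨j, s⟩ := γ
  rcases Int.units_eq_one_or s with rfl | rfl
  · exact csInf_le hbdd ⟨n, j, hn, hmem, rfl⟩
  · have e : move (j, 1) (move (j, -1) n) = n := move_move_invMove (j, 1) n
    refine csInf_le hbdd ⟨move (j, -1) n, j, hmem, by rwa [e], ?_⟩
    rw [e, add_comm]
    simp [invMove]

theorem kappaOne_pos (hd : 1 ≤ d) (hN : 2 ≤ N) (hA3 : AssumptionA3 N K h σ V) :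
    0 < kappaOne N K h σ V := by
  have hmemIff : ∀ n : Fin d → ℤ, n ∈ grid d N ↔ ∀ k, 1 ≤ n k ∧ n k ≤ N := fun n => by
    simp only [grid, Fintype.mem_piFinset, Finset.mem_Icc]
  have hfin : {r | ∃ (n : Fin d → ℤ) (j : Fin d), n ∈ grid d N ∧ move (j, 1) n ∈ grid d N ∧
      r = kappaMove N K h σ V n (j, 1) +
        kappaMove N K h σ V (move (j, 1) n) (j, -1)}.Finite := by
    refine (Set.finite_range fun p : Cell d N × Fin d => kappaMove N K h σ V p.1.1 (p.2, 1) +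
      kappaMove N K h σ V (move (p.2, 1) p.1.1) (p.2, -1)).subset ?_
    rintro r ⟨n, j, hn, -, rfl⟩
    exact ⟨(⟨n, hn⟩, j), rfl⟩
  have hmem1 : (fun _ => 1 : Fin d → ℤ) ∈ grid d N := by
    rw [hmemIff]
    omega
  have hmem2 : move (⟨0, hd⟩, 1) (fun _ => 1 : Fin d → ℤ) ∈ grid d N := by
    rw [hmemIff]
    intro k
    simp only [move, Pi.add_apply, Units.val_one]
    rcases eq_or_ne k ⟨0, hd⟩ with rfl | hk
    · rw [Pi.single_eq_same]
      omega
    · rw [Pi.single_eq_of_ne hk]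
      omega
  obtain ⟨n, j, hn, hmem, e⟩ :=
    Set.Nonempty.csInf_mem (by exact ⟨_, _, _, hmem1, hmem2, rfl⟩) hfin
  have hback : move (invMove (j, 1)) (move (j, 1) n) ∈ grid d N := by
    rwa [move_invMove_move]
  rw [kappaOne, e]
  exact add_pos (hA3 n hn _ hmem) (hA3 _ hmem _ hback)

/-- The edge contraction `gridEdgeSum_eulerStep_le` for the transition matrix of the scheme. -/
theorem edgeSum_transition_mulVec_le (hσ : 0 < σ) (hA3 : AssumptionA3 N K h σ V) {S : Set ℝ}
    {G : ℝ → ℝ → ℝ} (hG : HasAffineSupport S G) (hdiag : ∀ a, G a a = 0)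
    (hsymm : ∀ a b, G a b = G b a) (hG0 : ∀ a ∈ S, ∀ b ∈ S, 0 ≤ G a b) (hone : 1 ∈ S)
    {f : Cell d N → ℝ} (hf : ∀ i, f i ∈ S) (hPf : ∀ i, (transition N K h σ V *ᵥ f) i ∈ S) :
    edgeSum (transition N K h σ V) (invMeasure N K h σ V) G (transition N K h σ V *ᵥ f) ≤
      (1 - kappaOne N K h σ V * timeStep N K h σ V) *
        edgeSum (transition N K h σ V) (invMeasure N K h σ V) G f := by
  have hτ : 0 ≤ timeStep N K h σ V := inv_nonneg.2 totalRate_nonneg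
  have hmain := gridEdgeSum_eulerStep_le (isGridRates_rate (N := N) (K := K) (h := h) (V := V) hσ)
    hτ (fun n hn => timeStep_mul_sum_rate_le hn) hG hdiag hsymm hG0 (g := extendOne f)
    (fun n => by
      unfold extendOne
      split_ifs
      exacts [hf _, hone])
    (fun n hn => by
      rw [← transition_mulVec f ⟨n, hn⟩]
      exact hPf _)
    (fun n hn γ hmem => (hA3 n hn γ hmem).le)
    (fun n hn γ hmem => kappaOne_le hA3 hn hmem)
  have hw : 0 ≤ (∑ k : Cell d N, Real.exp (-meanV K h V k.1 / σ ^ 2))⁻¹ *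
      timeStep N K h σ V :=
    mul_nonneg (inv_nonneg.2 (Finset.sum_nonneg fun _ _ => (Real.exp_pos _).le)) hτ
  rw [edgeSum_transition hdiag (transition_mulVec f),
    edgeSum_transition hdiag fun i => (extendOne_coe f i).symm]
  have := mul_le_mul_of_nonneg_left hmain hw
  linarith

/-- One step of the chain contracts the entropy by the factor `1 - κ₁ τ`. -/
theorem phiEntropy_transition_mulVec_le (hd : 1 ≤ d) (hN : 2 ≤ N) (hh : 0 < h) (hσ : 0 < σ)
    (hA3 : AssumptionA3 N K h σ V) {f : Cell d N → ℝ} (hf : ∀ i, 0 ≤ f i) :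
    phiEntropy phiOne (transition N K h σ V *ᵥ f) (invMeasure N K h σ V) ≤
      (1 - kappaOne N K h σ V * timeStep N K h σ V) *
        phiEntropy phiOne f (invMeasure N K h σ V) := by
  have hT := totalRate_pos (K := K) (V := V) hd hN hh hσ
  have : Nonempty (Cell d N) := ⟨⟨fun _ => 1, by
    simp only [grid, Fintype.mem_piFinset, Finset.mem_Icc]
    omega⟩⟩
  have hP := isReversibleChain_transition (N := N) (K := K) (h := h) (V := V) hσ
  have hr : 1 - kappaOne N K h σ V * timeStep N K h σ V < 1 := by
    have := mul_pos (kappaOne_pos hd hN hA3) (inv_pos.2 hT)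
    rw [timeStep]
    linarith
  refine phiEntropy_mulVec_le hP hr (fun f hf => ?_) (fun f => ?_)
    (reflTransGen_transition hh hσ hT) hf
  · refine edgeSum_transition_mulVec_le hσ hA3 hasAffineSupport_logGap (fun a => ?_)
      (fun a b => ?_) ?_ (Set.mem_Ioi.2 one_pos) hf (hP.mulVec_pos hf)
    · rw [logGap, sub_self, zero_mul]
    · rw [logGap, logGap]
      ring
    · intro a (ha : 0 < a) b (hb : 0 < b)
      rw [logGap]
      rcases le_total a b with hab | hab
      · exact mul_nonneg_of_nonpos_of_nonpos (sub_nonpos.2 hab)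
          (sub_nonpos.2 (Real.log_le_log ha hab))
      · exact mul_nonneg (sub_nonneg.2 hab) (sub_nonneg.2 (Real.log_le_log hb hab))
  · refine edgeSum_transition_mulVec_le hσ hA3 hasAffineSupport_sqGap (fun a => ?_)
      (fun a b => ?_) (fun a _ b _ => sq_nonneg _) (Set.mem_univ _) (fun _ => Set.mem_univ _)
      (fun _ => Set.mem_univ _)
    · rw [sqGap, sub_self, zero_pow two_ne_zero]
    · rw [sqGap, sqGap]
      ring

end Scheme

end FokkerPlanckScheme

open FokkerPlanckScheme
theorem mainTheorem6 (d N : ℕ) (hd : 1 ≤ d) (hN : 2 ≤ N) (K h σ : ℝ)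
    (hK : 0 < K) (hh : 0 < h) (hKh : 2 * K / h = N) (hσ : 0 < σ)
    (V : EuclideanSpace ℝ (Fin d) → ℝ) (hV : ContDiff ℝ 2 V)
    (hadd : IsAdditive N K h V)
    (hA2 : AssumptionA2 K V)
    (hA3 : AssumptionA3 N K h σ V)
    (hLip : ∃ L : NNReal, LipschitzOnWith L (gradient V) (cube d K))
    (f : Cell d N → ℝ) (hf : ∀ i, 0 ≤ f i) (n : ℕ) :
    phiEntropy phiOne ((transition N K h σ V ^ n) *ᵥ f) (invMeasure N K h σ V) ≤
      Real.exp (-(kappaOne N K h σ V * n * timeStep N K h σ V)) *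
        phiEntropy phiOne f (invMeasure N K h σ V) := by
  have : Nonempty (Cell d N) := ⟨⟨fun _ => 1, by
    simp only [grid, Fintype.mem_piFinset, Finset.mem_Icc]
    omega⟩⟩
  have hP := isReversibleChain_transition (N := N) (K := K) (h := h) (V := V) hσ
  have hnn : ∀ n : ℕ, ∀ i, 0 ≤ ((transition N K h σ V ^ n) *ᵥ f) i := by
    intro n
    induction n with
    | zero => simpa using hf
    | succ n ih =>
      intro i
      rw [pow_succ', ← Matrix.mulVec_mulVec]
      exact Finset.sum_nonneg fun k _ => mul_nonneg (hP.nonneg i k) (ih k)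
  induction n with
  | zero => simp
  | succ n ih =>
    have hstep := phiEntropy_transition_mulVec_le hd hN hh hσ hA3 (hnn n)
    have h0 := phiEntropy_phiOne_nonneg (fun i => (hP.pos i).le) hP.sum_eq_one (hnn n)
    have hexp := Real.one_sub_le_exp_neg (kappaOne N K h σ V * timeStep N K h σ V)
    rw [pow_succ', ← Matrix.mulVec_mulVec]
    calc _ ≤ _ := hstep
      _ ≤ Real.exp (-(kappaOne N K h σ V * timeStep N K h σ V)) *
          phiEntropy phiOne ((transition N K h σ V ^ n) *ᵥ f) (invMeasure N K h σ V) :=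
        mul_le_mul_of_nonneg_right hexp h0
      _ ≤ Real.exp (-(kappaOne N K h σ V * timeStep N K h σ V)) * _ :=
        mul_le_mul_of_nonneg_left ih (Real.exp_pos _).le
      _ = _ := by
        rw [← mul_assoc, ← Real.exp_add]
        congr 2
        push_cast
        ring
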